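/- Fix a dimension $n\ge 1$. A \emph{cube} is a half-open cube $Q=\prod_{i=1}^n[a_i,a_i+\ell)$ with $\ell>0$, and $|E|$ denotes Lebesgue measure. $\mathcal D(Q)$ is the set of all cubes obtained from $Q$ by repeated subdivision into $2^n$ congruent subcubes, including $Q$ itself. A family $\mathcal F\subset\mathcal D(Q)$ is \emph{$\frac12$-sparse} if for every $P\in\mathcal F$ the set $E_P=P\setminus\bigcup_{P'\in\mathcal F,\,P'\subsetneq P}P'$ satisfies $|E_P|\ge\frac12|P|$. A \emph{weight} is a locally integrable function $w\colon\mathbb R^n\to(0,\infty)$, and $w(E)=\int_E w$. The Hardy--Littlewood maximal operator is $Mf(x)=\sup_{P\ni x}\frac1{|P|}\int_P|f|$, where the supremum is over all cubes containing $x$. The Fujii--Wilson constant of $w$ is $$[w]_{A_\infty}=\sup_Q\frac1{w(Q)}\int_Q M(w\chi_Q)\in[1,\infty].$$ For locally integrable $f\colon\mathbb R^n\to\mathbb R$ put $\langle f\rangle_Q=\frac1{|Q|}\int_Q f$ and $$\|f\|_{\mathrm{BMO}}=\sup_Q\frac1{|Q|}\int_Q|f-\langle f\rangle_Q|,\qquad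 \|f\|_{\mathrm{BMO}_{L^1(w)}}=\sup_Q\frac1{w(Q)}\int_Q|f-\langle f\rangle_Q|\,w .$$ All suprema over $Q$ are over all cubes. Then there is a constant $C>0$, depending only on $n$, such that for every weight $w$ (all quantities being allowed to be $+\infty$) $$C^{-1}[w]_{A_\infty}\le\sup_{\|f\|_{\mathrm{BMO}}\le1}\|f\|_{\mathrm{BMO}_{L^1(w)}}\le C\,[w]_{A_\infty}$$ (the supremum is over locally integrable $f$ with $\|f\|_{\mathrm{BMO}}\le 1$) and $$C^{-1}[w]_{A_\infty}\le\sup_{Q}\ \sup_{\mathcal F}\ \frac{\sum_{P\in\mathcal F}w(P)}{w(Q)}\le C\,[w]_{A_\infty},$$ where the inner supremum is over all $\frac12$-sparse families $\mathcal F\subset\mathcal D(Q)$. -/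

import Mathlib

open MeasureTheory Set
open scoped ENNReal NNReal

noncomputable section

namespace AInfty

/-- A (nondegenerate) cube in `ℝⁿ` with sides parallel to the axes, given by its lower corner
and its side length. -/
@[ext]
structure Cube (n : ℕ) where
  corner : Fin n → ℝ
  side : ℝ
  side_pos : 0 < side

variable {n : ℕ}

/-- The points of a cube.  Cubes are taken half-open, so that the subcubes of a dyadic
subdivision are pairwise disjoint. -/
def Cube.toSet (Q : Cube n) : Set (Fin n → ℝ) :=
  {x | ∀ i, Q.corner i ≤ x i ∧ x i < Q.corner i + Q.side}

/-- The family `𝒟(Q)` of all dyadic subcubes of `Q`: for every `k`, the `2 ^ (k * n)` congruent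
cubes of side `Q.side / 2 ^ k` obtained after `k` successive subdivisions. -/
def dyadic (Q : Cube n) : Set (Cube n) :=
  {P | ∃ (k : ℕ) (m : Fin n → ℕ), (∀ i, m i < 2 ^ k) ∧
    P.side = Q.side / 2 ^ k ∧ ∀ i, P.corner i = Q.corner i + (m i : ℝ) * (Q.side / 2 ^ k)}

/-- `E_P`: the part of `P` not covered by the cubes of `F` strictly contained in `P`. -/
def exclusivePart (F : Set (Cube n)) (P : Cube n) : Set (Fin n → ℝ) :=
  P.toSet \ ⋃ P' ∈ {P' ∈ F | P'.toSet ⊂ P.toSet}, P'.toSet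

/-- `F ⊆ 𝒟(Q)` is an `η`-sparse family. -/
def IsSparse (η : ℝ) (Q : Cube n) (F : Set (Cube n)) : Prop :=
  F ⊆ dyadic Q ∧
    ∀ P ∈ F, ENNReal.ofReal η * volume P.toSet ≤ volume (exclusivePart F P)

/-- A weight on `ℝⁿ`: a locally integrable function with values in `(0, ∞)`. -/
def IsWeight (w : (Fin n → ℝ) → ℝ) : Prop :=
  (∀ x, 0 < w x) ∧ LocallyIntegrable w volume

/-- `w(E) = ∫_E w`. -/
def wMass (w : (Fin n → ℝ) → ℝ) (E : Set (Fin n → ℝ)) : ℝ≥0∞ :=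
  ∫⁻ x in E, ENNReal.ofReal (w x)

/-- The Hardy--Littlewood maximal operator: the supremum of the means of `|f|` over all cubes
that contain `x`. -/
def maximalFn (f : (Fin n → ℝ) → ℝ) (x : Fin n → ℝ) : ℝ≥0∞ :=
  ⨆ (P : Cube n) (_ : x ∈ P.toSet), (∫⁻ y in P.toSet, ‖f y‖ₑ) / volume P.toSet

/-- The Fujii--Wilson constant `[w]_{A_∞}`. -/
def fujiiWilson (w : (Fin n → ℝ) → ℝ) : ℝ≥0∞ :=
  ⨆ Q : Cube n, (∫⁻ x in Q.toSet, maximalFn (Q.toSet.indicator w) x) / wMass w Q.toSet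

/-- The supremum of `∑_{P ∈ F} w(P) / w(Q)` over all cubes `Q` and all `η`-sparse families
`F ⊆ 𝒟(Q)`. -/
def sparseConst (η : ℝ) (w : (Fin n → ℝ) → ℝ) : ℝ≥0∞ :=
  ⨆ (Q : Cube n) (F : Set (Cube n)) (_ : IsSparse η Q F),
    (∑' P : F, wMass w P.1.toSet) / wMass w Q.toSet

/-- The mean `⟨f⟩_Q`. -/
def mean (f : (Fin n → ℝ) → ℝ) (Q : Cube n) : ℝ :=
  ⨍ x in Q.toSet, f x

/-- `‖f‖_BMO` (possibly infinite), for locally integrable `f`. -/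
def bmoNorm (f : (Fin n → ℝ) → ℝ) : ℝ≥0∞ :=
  ⨆ Q : Cube n, (∫⁻ x in Q.toSet, ‖f x - mean f Q‖ₑ) / volume Q.toSet

/-- `‖f‖_{BMO_{L¹(w)}}` (possibly infinite), for locally integrable `f`:
the supremum over all cubes `Q` of `w(Q)⁻¹ ∫_Q |f - ⟨f⟩_Q| w`. The mean `⟨f⟩_Q` is taken with
respect to Lebesgue measure. -/
def bmoWeightedNorm (w f : (Fin n → ℝ) → ℝ) : ℝ≥0∞ :=
  ⨆ Q : Cube n,
    (∫⁻ x in Q.toSet, ‖f x - mean f Q‖ₑ * ENNReal.ofReal (w x)) / wMass w Q.toSet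

/-- The supremum of `‖f‖_{BMO_{L¹(w)}}` over all locally integrable `f` with `‖f‖_BMO ≤ 1`. -/
def bmoEmbeddingConst (w : (Fin n → ℝ) → ℝ) : ℝ≥0∞ :=
  ⨆ (f : (Fin n → ℝ) → ℝ) (_ : LocallyIntegrable f volume) (_ : bmoNorm f ≤ 1),
    bmoWeightedNorm w f

end AInfty

end

open MeasureTheory Set
open scoped ENNReal NNReal

noncomputable section

namespace AInfty

variable {n : ℕ}

/-! ### Cubes -/

/-! The sparse constant mediates: it is comparable with both the Fujii–Wilson constant and the `BMO`
embedding constant.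

Sparse and Fujii–Wilson: on the disjoint sets `E_P` the maximal function is at least `w(P)/|P|`,
while `|P| ≤ 2|E_P|`; this gives `sparseConst_le_fujiiWilson`. Conversely, stop whenever the average
of `w` doubles. The stopping cubes are sparse, and the maximal function is dominated by the sum of
`w(P)/|P|` over the stopping cubes `P` with `x ∈ 3P`; integration gives
`fujiiWilson_le_sparseConst`.

Sparse and `BMO`: stop whenever the oscillation about the last stopping mean exceeds `2`. By
Lebesgue differentiation `|f - ⟨f⟩_Q|` is almost everywhere at most `2^(n+1)` times the number of
stopping cubes around the point (`bmoEmbeddingConst_le_sparseConst`). Conversely, the sum of the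
indicators of a sparse family should be a `BMO` function to test with. Since `BMO` is tested on all
cubes, not only dyadic ones, each indicator is replaced by a Lipschitz bump at its own scale; coarse
bumps are then almost constant on a given cube, and fine ones are controlled by Carleson packing
(`exists_lintegral_bumpSum_sub_le`, `sparseConst_le_bmoEmbeddingConst`). -/

theorem Cube.toSet_eq_pi (Q : Cube n) :
    Q.toSet = univ.pi fun i => Ico (Q.corner i) (Q.corner i + Q.side) := by
  ext x; simp [Cube.toSet]

theorem Cube.measurableSet_toSet (Q : Cube n) : MeasurableSet Q.toSet := by
  rw [Q.toSet_eq_pi]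
  exact MeasurableSet.univ_pi fun i => measurableSet_Ico

theorem Cube.volume_toSet (Q : Cube n) : volume Q.toSet = ENNReal.ofReal Q.side ^ n := by
  rw [Q.toSet_eq_pi, Real.volume_pi_Ico]
  simp

theorem Cube.volume_ne_zero (Q : Cube n) : volume Q.toSet ≠ 0 := by
  rw [Q.volume_toSet]
  exact pow_ne_zero _ (by simpa using Q.side_pos)

theorem Cube.volume_ne_top (Q : Cube n) : volume Q.toSet ≠ ∞ := by
  rw [Q.volume_toSet]
  exact ENNReal.pow_ne_top ENNReal.ofReal_ne_top

/-- The concentric cube whose side is `2 * t + 1` times as long. -/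
def Cube.dilate (Q : Cube n) (t : ℕ) : Cube n where
  corner i := Q.corner i - t * Q.side
  side := (2 * t + 1 : ℕ) * Q.side
  side_pos := mul_pos (by positivity) Q.side_pos

theorem Cube.volume_dilate (Q : Cube n) (t : ℕ) :
    volume (Q.dilate t).toSet = (2 * t + 1 : ℕ) ^ n * volume Q.toSet := by
  rw [Cube.volume_toSet, Cube.volume_toSet, Cube.dilate, ENNReal.ofReal_mul (by positivity),
    mul_pow, ENNReal.ofReal_natCast]

theorem Cube.dist_lt_side {Q : Cube n} {x y : Fin n → ℝ} (hx : x ∈ Q.toSet) (hy : y ∈ Q.toSet)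
    (i : Fin n) : |x i - y i| < Q.side := by
  have := hx i; have := hy i
  rw [abs_lt]; constructor <;> linarith

theorem Cube.toSet_subset_closedBall (Q : Cube n) {x : Fin n → ℝ} (hx : x ∈ Q.toSet) :
    Q.toSet ⊆ Metric.closedBall x Q.side := fun y hy => by
  rw [Metric.mem_closedBall, dist_pi_le_iff Q.side_pos.le]
  exact fun i => (Cube.dist_lt_side hy hx i).le

theorem Cube.dilate_subset_dilate {P R : Cube n} (hside : P.side ≤ R.side)
    (h : P.toSet ⊆ R.toSet) (t : ℕ) : (P.dilate t).toSet ⊆ (R.dilate t).toSet := by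
  have hc : P.corner ∈ R.toSet := h fun i => ⟨le_rfl, by linarith [P.side_pos]⟩
  have key : ∀ i, P.corner i + P.side ≤ R.corner i + R.side := by
    intro i
    by_contra! hlt
    -- Pushing the corner of `P` in direction `i` onto the upper face of `R` stays inside `P` if `P`
    -- overshoots, but leaves the half-open `R`.
    set e := (R.corner i + R.side - P.corner i)
    have he : 0 < e := by have := (hc i).2; simp only [e]; linarith
    have : (fun j => P.corner j + if j = i then e else 0) ∈ P.toSet := by
      intro j
      by_cases hj : j = i
      · subst hj; simp only [if_true]; constructor <;> simp only [e] at * <;> linarith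
      · simp only [hj, if_false]; constructor <;> linarith [P.side_pos]
    have := (h this i).2
    simp [e] at this
  intro x hx i
  obtain ⟨h1, h2⟩ := hx i
  have h3 := key i
  have h4 := (hc i).1
  have h5 : (t : ℝ) * P.side ≤ t * R.side := by gcongr
  simp only [Cube.dilate] at *
  push_cast at *
  constructor <;> nlinarith

/-! ### Dyadic subcubes -/

/-- The dyadic subcube of `Q` of generation `k` with multi-index `m`. -/
def dyadicCube (Q : Cube n) (k : ℕ) (m : Fin n → ℕ) : Cube n where
  corner i := Q.corner i + (m i : ℝ) * (Q.side / 2 ^ k)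
  side := Q.side / 2 ^ k
  side_pos := div_pos Q.side_pos (by positivity)

/-- The multi-index of the dyadic subcube of generation `k` which contains `x`. -/
def dyadicIndex (Q : Cube n) (k : ℕ) (x : Fin n → ℝ) (i : Fin n) : ℕ :=
  ⌊(x i - Q.corner i) / (Q.side / 2 ^ k)⌋₊

/-- The dyadic subcube of generation `k` which contains `x`. -/
def cubeAt (Q : Cube n) (k : ℕ) (x : Fin n → ℝ) : Cube n :=
  dyadicCube Q k (dyadicIndex Q k x)

variable {Q : Cube n} {x y : Fin n → ℝ} {j k : ℕ}

theorem mem_dyadic_iff {P : Cube n} :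
    P ∈ dyadic Q ↔ ∃ (k : ℕ) (m : Fin n → ℕ), (∀ i, m i < 2 ^ k) ∧ P = dyadicCube Q k m := by
  constructor
  · rintro ⟨k, m, hm, hs, hc⟩
    exact ⟨k, m, hm, Cube.ext (funext hc) hs⟩
  · rintro ⟨k, m, hm, rfl⟩
    exact ⟨k, m, hm, rfl, fun i => rfl⟩

theorem countable_dyadic (Q : Cube n) : (dyadic Q).Countable := by
  refine (countable_range fun p : ℕ × (Fin n → ℕ) => dyadicCube Q p.1 p.2).mono ?_
  intro P hP
  obtain ⟨k, m, -, rfl⟩ := mem_dyadic_iff.1 hP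
  exact ⟨(k, m), rfl⟩

/-- The lower bounds are needed because the natural-number floor sends negative quotients to `0`, so
index `0` alone would also catch points below `Q`. -/
theorem mem_dyadicCube_iff {m : Fin n → ℕ} :
    x ∈ (dyadicCube Q k m).toSet ↔ (∀ i, Q.corner i ≤ x i) ∧ dyadicIndex Q k x = m := by
  have hs : 0 < Q.side / 2 ^ k := (dyadicCube Q k m).side_pos
  rw [funext_iff, ← forall_and]
  refine forall_congr' fun i => ?_
  simp only [dyadicCube, dyadicIndex]
  constructor
  · rintro ⟨h1, h2⟩
    have h0 : Q.corner i ≤ x i := le_trans (by have : (0:ℝ) ≤ m i * (Q.side / 2 ^ k) := by positivity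
                                               linarith) h1
    refine ⟨h0, ?_⟩
    rw [Nat.floor_eq_iff (div_nonneg (by linarith) hs.le), le_div_iff₀ hs, div_lt_iff₀ hs]
    constructor <;> linarith
  · rintro ⟨h0, h⟩
    rw [Nat.floor_eq_iff (div_nonneg (by linarith) hs.le), le_div_iff₀ hs, div_lt_iff₀ hs] at h
    constructor <;> linarith

theorem cubeAt_side : (cubeAt Q k x).side = Q.side / 2 ^ k := rfl

theorem mem_cubeAt (hx : x ∈ Q.toSet) : x ∈ (cubeAt Q k x).toSet :=
  mem_dyadicCube_iff.2 ⟨fun i => (hx i).1, rfl⟩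

theorem dyadicIndex_lt (hx : x ∈ Q.toSet) (i : Fin n) : dyadicIndex Q k x i < 2 ^ k := by
  have hs := Q.side_pos
  have := hx i
  rw [dyadicIndex, Nat.floor_lt (div_nonneg (by linarith) (by positivity)),
    div_lt_iff₀ (by positivity)]
  push_cast
  rw [mul_div_cancel₀ _ (by positivity)]
  linarith

theorem cubeAt_mem_dyadic (hx : x ∈ Q.toSet) : cubeAt Q k x ∈ dyadic Q :=
  mem_dyadic_iff.2 ⟨k, _, dyadicIndex_lt hx, rfl⟩

/-- Passing to an ancestor drops `l` binary digits of the index; the nesting of dyadic cubes rests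
on this. -/
theorem dyadicIndex_add (k l : ℕ) (i : Fin n) :
    dyadicIndex Q (k + l) x i / 2 ^ l = dyadicIndex Q k x i := by
  rw [dyadicIndex, dyadicIndex, ← Nat.floor_div_natCast]
  congr 1
  have := Q.side_pos
  push_cast
  rw [pow_add]
  field_simp

theorem cubeAt_eq_of_mem (hjk : j ≤ k) (h : y ∈ (cubeAt Q k x).toSet) :
    cubeAt Q j y = cubeAt Q j x := by
  obtain ⟨l, rfl⟩ := Nat.exists_eq_add_of_le hjk
  have h := (mem_dyadicCube_iff.1 h).2
  rw [cubeAt, cubeAt]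
  congr 1
  funext i
  rw [← dyadicIndex_add j l, ← dyadicIndex_add j l, h]

theorem cubeAt_zero (hx : x ∈ Q.toSet) : cubeAt Q 0 x = Q := by
  have h : dyadicIndex Q 0 x = 0 := funext fun i => by simpa using dyadicIndex_lt (k := 0) hx i
  ext <;> simp [cubeAt, h, dyadicCube]

theorem le_of_mem_dyadicCube {m : Fin n → ℕ} (h : x ∈ (dyadicCube Q k m).toSet) (i : Fin n) :
    Q.corner i ≤ x i := (mem_dyadicCube_iff.1 h).1 i

theorem cubeAt_subset_cubeAt (hjk : j ≤ k) :
    (cubeAt Q k x).toSet ⊆ (cubeAt Q j x).toSet := fun y hy => by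
  rw [← cubeAt_eq_of_mem hjk hy]
  exact mem_dyadicCube_iff.2 ⟨le_of_mem_dyadicCube hy, rfl⟩

theorem cubeAt_subset (hx : x ∈ Q.toSet) : (cubeAt Q k x).toSet ⊆ Q.toSet := by
  simpa only [cubeAt_zero hx] using cubeAt_subset_cubeAt (Q := Q) (x := x) (Nat.zero_le k)

theorem dyadicCube_corner_mem (Q : Cube n) {m : Fin n → ℕ} (hm : ∀ i, m i < 2 ^ k) :
    (dyadicCube Q k m).corner ∈ Q.toSet := fun i => by
  have hs := Q.side_pos
  have h1 : (m i : ℝ) < 2 ^ k := mod_cast hm i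
  simp only [dyadicCube]
  refine ⟨by have : 0 ≤ (m i : ℝ) * (Q.side / 2 ^ k) := by positivity
             linarith, ?_⟩
  have : (m i : ℝ) * (Q.side / 2 ^ k) < 2 ^ k * (Q.side / 2 ^ k) := by gcongr
  rw [mul_div_cancel₀ _ (by positivity)] at this
  linarith

theorem Cube.corner_mem (Q : Cube n) : Q.corner ∈ Q.toSet :=
  fun i => ⟨le_rfl, by linarith [Q.side_pos]⟩

/-- Every dyadic subcube is the dyadic cube around each of its points. -/
theorem exists_eq_cubeAt {P : Cube n} (hP : P ∈ dyadic Q) :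
    P.toSet ⊆ Q.toSet ∧ ∃ k, P.side = Q.side / 2 ^ k ∧ ∀ x ∈ P.toSet, P = cubeAt Q k x := by
  obtain ⟨k, m, hm, rfl⟩ := mem_dyadic_iff.1 hP
  have key : ∀ x ∈ (dyadicCube Q k m).toSet, dyadicCube Q k m = cubeAt Q k x := fun x hx => by
    rw [cubeAt, (mem_dyadicCube_iff.1 hx).2]
  refine ⟨?_, k, rfl, key⟩
  rw [key _ (Cube.corner_mem _)]
  exact cubeAt_subset (dyadicCube_corner_mem Q hm)


theorem strictAnti_side (Q : Cube n) : StrictAnti fun k : ℕ => Q.side / 2 ^ k := fun a b h =>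
  div_lt_div_of_pos_left Q.side_pos (by positivity) (pow_lt_pow_right₀ (by norm_num) h)

/-- Strictness is seen from the volumes. In dimension `0` all cubes coincide, so `1 ≤ n` is
essential. -/
theorem cubeAt_ssubset (hn : 1 ≤ n) (hjk : j < k) :
    (cubeAt Q k x).toSet ⊂ (cubeAt Q j x).toSet := by
  refine (cubeAt_subset_cubeAt hjk.le).ssubset_of_ne fun h => ?_
  have h := congrArg volume h
  rw [Cube.volume_toSet, Cube.volume_toSet] at h
  have h := (ENNReal.pow_right_strictMono (n := n) (by omega)).injective h
  rw [ENNReal.ofReal_eq_ofReal_iff (Cube.side_pos _).le (Cube.side_pos _).le] at h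
  exact (strictAnti_side Q hjk).ne h

theorem lt_of_cubeAt_ssubset (h : (cubeAt Q k x).toSet ⊂ (cubeAt Q j x).toSet) : j < k := by
  by_contra! hle
  exact h.not_subset (cubeAt_subset_cubeAt hle)

theorem volume_cubeAt (k : ℕ) : 2 ^ (k * n) * volume (cubeAt Q k x).toSet = volume Q.toSet := by
  rw [Cube.volume_toSet, Cube.volume_toSet, cubeAt_side, pow_mul, ← mul_pow]
  congr 1
  rw [ENNReal.ofReal_div_of_pos (by positivity), ENNReal.ofReal_pow (by norm_num)]
  simp only [ENNReal.ofReal_ofNat]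
  exact ENNReal.mul_div_cancel (by simp) (by simp)

theorem volume_cubeAt_succ (k : ℕ) :
    2 ^ n * volume (cubeAt Q (k + 1) x).toSet = volume (cubeAt Q k x).toSet := by
  rw [Cube.volume_toSet, Cube.volume_toSet, cubeAt_side, cubeAt_side, ← mul_pow, pow_succ,
    ← div_div, ENNReal.ofReal_div_of_pos two_pos]
  simp only [ENNReal.ofReal_ofNat]
  rw [ENNReal.mul_div_cancel (by simp) (by simp)]

/-- The exclusive parts of a family of dyadic cubes are pairwise disjoint. -/
theorem exclusivePart_disjoint (hn : 1 ≤ n) {F : Set (Cube n)} (hF : F ⊆ dyadic Q) :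
    F.PairwiseDisjoint (exclusivePart F) := by
  -- A point of `E_P` has `P` as its smallest cube in `F`; this determines `P`.
  have key : ∀ P ∈ F, ∀ R ∈ F, ∀ x ∈ exclusivePart F P, x ∈ R.toSet →
      ∀ k l, P = cubeAt Q k x → R = cubeAt Q l x → l ≤ k := by
    rintro P hP R hR x hx hxR k l rfl rfl
    by_contra! hlt
    refine hx.2 (mem_biUnion (x := cubeAt Q l x) ⟨hR, cubeAt_ssubset hn hlt⟩ hxR)
  intro P hP R hR hne
  refine Set.disjoint_left.2 fun x hxP hxR => hne ?_
  obtain ⟨-, k, -, hk⟩ := exists_eq_cubeAt (hF hP)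
  obtain ⟨-, l, -, hl⟩ := exists_eq_cubeAt (hF hR)
  have hk := hk x hxP.1
  have hl := hl x hxR.1
  have := key P hP R hR x hxP hxR.1 k l hk hl
  have := key R hR P hP x hxR hxP.1 l k hl hk
  rw [hk, hl, show k = l by omega]

theorem exclusivePart_subset (F : Set (Cube n)) (P : Cube n) : exclusivePart F P ⊆ P.toSet :=
  sdiff_subset

theorem measurableSet_exclusivePart {F : Set (Cube n)} (hF : F.Countable) (P : Cube n) :
    MeasurableSet (exclusivePart F P) :=
  P.measurableSet_toSet.diff <| MeasurableSet.biUnion (hF.mono (sep_subset _ _))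
    fun R _ => R.measurableSet_toSet

/-! ### Stopping families and sparseness -/

theorem dyadicCube_disjoint (Q : Cube n) (k : ℕ) (I : Set (Fin n → ℕ)) :
    I.PairwiseDisjoint fun m => (dyadicCube Q k m).toSet := fun _ _ _ _ hab =>
  Set.disjoint_left.2 fun _ ha hb =>
    hab ((mem_dyadicCube_iff.1 ha).2.symm.trans (mem_dyadicCube_iff.1 hb).2)

/-- Comparing two measures on a union of dyadic cubes by passing to the maximal ones. -/
theorem measure_biUnion_dyadic_le (Q : Cube n) (μ ν : Measure (Fin n → ℝ)) (S : Cube n → Prop)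
    (h : ∀ P ∈ dyadic Q, S P → μ P.toSet ≤ ν P.toSet) :
    μ (⋃ P ∈ {P ∈ dyadic Q | S P}, P.toSet) ≤ ν Q.toSet := by
  -- `T k` collects the points whose first cube with property `S` has generation `k`. These sets are
  -- disjoint, and each is a union of maximal cubes.
  let T : ℕ → Set (Fin n → ℝ) := fun k =>
    {x ∈ Q.toSet | S (cubeAt Q k x) ∧ ∀ j < k, ¬ S (cubeAt Q j x)}
  have hT : ∀ k, T k = ⋃ m ∈ dyadicIndex Q k '' T k, (dyadicCube Q k m).toSet := by
    intro k
    ext x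
    simp only [mem_iUnion, exists_prop]
    constructor
    · exact fun hx => ⟨_, mem_image_of_mem _ hx, mem_cubeAt hx.1⟩
    · rintro ⟨m, ⟨y, hy, rfl⟩, hx⟩
      refine ⟨cubeAt_subset hy.1 hx, ?_, fun j hj => ?_⟩
      · rw [cubeAt_eq_of_mem le_rfl hx]; exact hy.2.1
      · rw [cubeAt_eq_of_mem hj.le hx]; exact hy.2.2 j hj
  have hTmeas : ∀ k, MeasurableSet (T k) := fun k => by
    rw [hT k]
    exact MeasurableSet.biUnion (to_countable _) fun m _ => Cube.measurableSet_toSet _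
  have hTle : ∀ k, μ (T k) ≤ ν (T k) := fun k => by
    rw [hT k, measure_biUnion (to_countable _) (dyadicCube_disjoint Q k _)
        fun m _ => Cube.measurableSet_toSet _,
      measure_biUnion (to_countable _) (dyadicCube_disjoint Q k _)
        fun m _ => Cube.measurableSet_toSet _]
    refine ENNReal.tsum_le_tsum ?_
    rintro ⟨m, y, hy, rfl⟩
    exact h (cubeAt Q k y) (cubeAt_mem_dyadic hy.1) hy.2.1
  have hdisj : Pairwise (Function.onFun Disjoint T) := by
    intro a b hab
    refine Set.disjoint_left.2 fun x ha hb => ?_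
    rcases lt_or_gt_of_ne hab with hlt | hlt
    · exact hb.2.2 a hlt ha.2.1
    · exact ha.2.2 b hlt hb.2.1
  have hsub : (⋃ P ∈ {P ∈ dyadic Q | S P}, P.toSet) ⊆ ⋃ k, T k := by
    intro x hx
    simp only [mem_iUnion, exists_prop] at hx
    obtain ⟨P, ⟨hP, hS⟩, hx⟩ := hx
    obtain ⟨hPQ, k, -, hk⟩ := exists_eq_cubeAt hP
    classical
    have hex : ∃ k, S (cubeAt Q k x) := ⟨k, hk x hx ▸ hS⟩
    exact mem_iUnion.2 ⟨Nat.find hex, hPQ hx, Nat.find_spec hex, fun j hj => Nat.find_min hex hj⟩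
  calc μ (⋃ P ∈ {P ∈ dyadic Q | S P}, P.toSet) ≤ μ (⋃ k, T k) := measure_mono hsub
    _ = ∑' k, μ (T k) := measure_iUnion hdisj hTmeas
    _ ≤ ∑' k, ν (T k) := ENNReal.tsum_le_tsum hTle
    _ = ν (⋃ k, T k) := (measure_iUnion hdisj hTmeas).symm
    _ ≤ ν Q.toSet := measure_mono (iUnion_subset fun k x hx => hx.1)

open scoped Classical in
/-- The generation of the last stopping cube, up to generation `k`, on the way down to `x`:
after the stopping cube `P` the next one is the first `P'` with `sel P P'`. -/
def stopGen (Q : Cube n) (sel : Cube n → Cube n → Prop) : ℕ → (Fin n → ℝ) → ℕ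
  | 0, _ => 0
  | k + 1, x =>
    if sel (cubeAt Q (stopGen Q sel k x) x) (cubeAt Q (k + 1) x) then k + 1
    else stopGen Q sel k x

/-- The family of all stopping cubes. -/
def stopFamily (Q : Cube n) (sel : Cube n → Cube n → Prop) : Set (Cube n) :=
  {P | ∃ k, ∃ x ∈ Q.toSet, stopGen Q sel k x = k ∧ P = cubeAt Q k x}

variable {sel : Cube n → Cube n → Prop}

theorem stopGen_succ_of_stop
    (h : sel (cubeAt Q (stopGen Q sel k x) x) (cubeAt Q (k + 1) x)) :
    stopGen Q sel (k + 1) x = k + 1 := by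
  rw [stopGen, if_pos h]

theorem stopGen_succ_of_not_stop
    (h : ¬ sel (cubeAt Q (stopGen Q sel k x) x) (cubeAt Q (k + 1) x)) :
    stopGen Q sel (k + 1) x = stopGen Q sel k x := by
  rw [stopGen, if_neg h]

theorem stopGen_le (k : ℕ) (x : Fin n → ℝ) : stopGen Q sel k x ≤ k := by
  induction k with
  | zero => exact le_rfl
  | succ k ih =>
    by_cases h : sel (cubeAt Q (stopGen Q sel k x) x) (cubeAt Q (k + 1) x)
    · rw [stopGen_succ_of_stop h]
    · rw [stopGen_succ_of_not_stop h]; omega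

/-- The recursion up to `k` only inspects cubes of generation at most `k`, which `x` and `y` share.
-/
theorem stopGen_eq_of_mem (h : y ∈ (cubeAt Q k x).toSet) :
    stopGen Q sel k y = stopGen Q sel k x := by
  induction k with
  | zero => rfl
  | succ k ih =>
    have h' := cubeAt_subset_cubeAt (Nat.le_succ k) h
    simp only [stopGen]
    rw [ih h', cubeAt_eq_of_mem ((stopGen_le k x).trans (Nat.le_succ k)) h,
      cubeAt_eq_of_mem le_rfl h]

theorem stopGen_stopGen (k : ℕ) (x : Fin n → ℝ) :
    stopGen Q sel (stopGen Q sel k x) x = stopGen Q sel k x := by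
  induction k with
  | zero => rfl
  | succ k ih =>
    by_cases h : sel (cubeAt Q (stopGen Q sel k x) x) (cubeAt Q (k + 1) x)
    · rw [stopGen_succ_of_stop h, stopGen_succ_of_stop h]
    · rw [stopGen_succ_of_not_stop h, ih]

theorem cubeAt_stopGen_mem (hx : x ∈ Q.toSet) :
    cubeAt Q (stopGen Q sel k x) x ∈ stopFamily Q sel :=
  ⟨_, x, hx, stopGen_stopGen k x, rfl⟩

theorem stopFamily_subset : stopFamily Q sel ⊆ dyadic Q := by
  rintro P ⟨k, x, hx, -, rfl⟩
  exact cubeAt_mem_dyadic hx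

/-- A cube selected at generation `k` would itself be the last stopping cube; irreflexivity covers
exactly that case. -/
theorem not_stop_cubeAt (hrefl : ∀ P ∈ dyadic Q, ¬ sel P P) (hx : x ∈ Q.toSet) (k : ℕ) :
    ¬ sel (cubeAt Q (stopGen Q sel k x) x) (cubeAt Q k x) := by
  cases k with
  | zero => exact hrefl _ (cubeAt_mem_dyadic hx)
  | succ k =>
    by_cases h : sel (cubeAt Q (stopGen Q sel k x) x) (cubeAt Q (k + 1) x)
    · rw [stopGen_succ_of_stop h]; exact hrefl _ (cubeAt_mem_dyadic hx)
    · rw [stopGen_succ_of_not_stop h]; exact h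

theorem exists_stop_of_stopGen_ne (hjk : j ≤ k) (hj : stopGen Q sel j x = j)
    (hk : stopGen Q sel k x ≠ j) :
    ∃ l, j < l ∧ sel (cubeAt Q j x) (cubeAt Q l x) := by
  induction k, hjk using Nat.le_induction with
  | base => exact absurd hj hk
  | succ k hjk ih =>
    by_cases h : stopGen Q sel k x = j
    · by_cases hs : sel (cubeAt Q (stopGen Q sel k x) x) (cubeAt Q (k + 1) x)
      · exact ⟨k + 1, by omega, h ▸ hs⟩
      · exact absurd (stopGen_succ_of_not_stop hs ▸ h) hk
    · exact ih h

/-- If a smaller stopping cube contains `y`, the first stop below `P` on the way to `y` was selected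
against `P` itself. Hence only selections relative to `P` can remove points from `E_P`. -/
theorem diff_subset_exclusivePart_stopFamily {P : Cube n} (hP : P ∈ stopFamily Q sel) :
    P.toSet \ ⋃ R ∈ {R ∈ dyadic Q | R.toSet ⊆ P.toSet ∧ sel P R}, R.toSet ⊆
      exclusivePart (stopFamily Q sel) P := by
  rintro y ⟨hyP, hy⟩
  refine ⟨hyP, fun hyF => hy ?_⟩
  simp only [mem_iUnion, exists_prop] at hyF ⊢
  obtain ⟨R, ⟨hRF, hRP⟩, hyR⟩ := hyF
  obtain ⟨k, x, hx, hk, rfl⟩ := hP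
  obtain ⟨l, z, hz, hl, rfl⟩ := hRF
  have hyQ := cubeAt_subset hx hyP
  rw [← stopGen_eq_of_mem hyP] at hk
  rw [← stopGen_eq_of_mem hyR] at hl
  rw [← cubeAt_eq_of_mem le_rfl hyP] at hRP ⊢
  rw [← cubeAt_eq_of_mem le_rfl hyR] at hRP
  have hkl := lt_of_cubeAt_ssubset hRP
  obtain ⟨i, hi, hs⟩ := exists_stop_of_stopGen_ne hkl.le hk (by omega)
  exact ⟨cubeAt Q i y, ⟨cubeAt_mem_dyadic hyQ, cubeAt_subset_cubeAt hi.le, hs⟩, mem_cubeAt hyQ⟩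

/-- A stopping family is sparse if the stopping condition selects at most half of each cube,
which it suffices to see from a comparison measure. -/
theorem isSparse_stopFamily
    (h : ∀ P ∈ dyadic Q, ∃ ν : Measure (Fin n → ℝ), 2 * ν P.toSet ≤ volume P.toSet ∧
      ∀ R ∈ dyadic Q, R.toSet ⊆ P.toSet → sel P R → volume R.toSet ≤ ν R.toSet) :
    IsSparse (1 / 2) Q (stopFamily Q sel) := by
  refine ⟨stopFamily_subset, fun P hP => ?_⟩
  obtain ⟨ν, hν, hR⟩ := h P (stopFamily_subset hP)
  set U := ⋃ R ∈ {R ∈ dyadic Q | R.toSet ⊆ P.toSet ∧ sel P R}, R.toSet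
  have hU : volume U ≤ ν P.toSet := by
    -- The comparison yields the mass of all of `Q`; restricting `ν` to `P` reduces this to `ν P`.
    refine (measure_biUnion_dyadic_le Q volume (ν.restrict P.toSet) _ ?_).trans
      (Measure.restrict_apply Q.measurableSet_toSet |>.trans_le (measure_mono inter_subset_right))
    · rintro R hRQ ⟨hRP, hs⟩
      rw [Measure.restrict_eq_self _ hRP]
      exact hR R hRQ hRP hs
  have hhalf : ENNReal.ofReal (1 / 2) = 2⁻¹ := by
    rw [one_div, ENNReal.ofReal_inv_of_pos two_pos, ENNReal.ofReal_ofNat]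
  have hU2 : volume U ≤ 2⁻¹ * volume P.toSet := by
    refine hU.trans ?_
    rw [← ENNReal.div_eq_inv_mul, ENNReal.le_div_iff_mul_le (by simp) (by simp), mul_comm]
    exact hν
  have hadd : volume P.toSet ≤ 2⁻¹ * volume P.toSet + volume (P.toSet \ U) :=
    calc volume P.toSet ≤ volume (U ∪ P.toSet \ U) := measure_mono fun z hz => by
          by_cases hzU : z ∈ U
          · exact Or.inl hzU
          · exact Or.inr ⟨hz, hzU⟩
      _ ≤ volume U + volume (P.toSet \ U) := measure_union_le _ _
      _ ≤ _ := by gcongr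
  rw [hhalf]
  refine le_trans ?_ (measure_mono (diff_subset_exclusivePart_stopFamily hP))
  have hsplit : volume P.toSet = 2⁻¹ * volume P.toSet + 2⁻¹ * volume P.toSet := by
    rw [← add_mul, ENNReal.inv_two_add_inv_two, one_mul]
  nth_rw 1 [hsplit] at hadd
  exact (ENNReal.add_le_add_iff_left
    (ENNReal.mul_ne_top (by simp) P.volume_ne_top)).1 hadd

theorem IsSparse.volume_le {F : Set (Cube n)} (hF : IsSparse (1 / 2) Q F) {P : Cube n}
    (hP : P ∈ F) : volume P.toSet ≤ 2 * volume (exclusivePart F P) := by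
  have h := hF.2 P hP
  rw [one_div, ENNReal.ofReal_inv_of_pos two_pos, ENNReal.ofReal_ofNat] at h
  calc volume P.toSet = 2 * (2⁻¹ * volume P.toSet) := by
        rw [← mul_assoc, ENNReal.mul_inv_cancel (by simp) (by simp), one_mul]
    _ ≤ _ := by gcongr

/-- The Carleson packing property of sparse families. -/
theorem IsSparse.tsum_volume_le (hn : 1 ≤ n) {F G : Set (Cube n)} (hF : IsSparse (1 / 2) Q F)
    (hG : G ⊆ F) {A : Set (Fin n → ℝ)} (hA : ∀ P ∈ G, P.toSet ⊆ A) :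
    ∑' P : G, volume P.1.toSet ≤ 2 * volume A := by
  have hFc := (countable_dyadic Q).mono hF.1
  calc ∑' P : G, volume P.1.toSet ≤ ∑' P : G, 2 * volume (exclusivePart F P.1) :=
        ENNReal.tsum_le_tsum fun P => hF.volume_le (hG P.2)
    _ = 2 * volume (⋃ P ∈ G, exclusivePart F P) := by
        rw [ENNReal.tsum_mul_left, measure_biUnion (hFc.mono hG)
          ((exclusivePart_disjoint hn hF.1).subset hG)
          fun P _ => measurableSet_exclusivePart hFc P]
    _ ≤ 2 * volume A := by
        gcongr
        exact iUnion₂_subset fun P hP => (exclusivePart_subset F P).trans (hA P hP)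

/-! ### Weights -/

variable {w : (Fin n → ℝ) → ℝ}

/-- The measure `w dx`. -/
def weightMeasure (w : (Fin n → ℝ) → ℝ) : Measure (Fin n → ℝ) :=
  volume.withDensity fun x => ENNReal.ofReal (w x)

theorem weightMeasure_apply (w : (Fin n → ℝ) → ℝ) {E : Set (Fin n → ℝ)} (hE : MeasurableSet E) :
    weightMeasure w E = wMass w E :=
  withDensity_apply _ hE

theorem wMass_mono {E E' : Set (Fin n → ℝ)} (h : E ⊆ E') : wMass w E ≤ wMass w E' :=
  lintegral_mono_set h

theorem _root_.MeasureTheory.LocallyIntegrable.integrableOn_cube {f : (Fin n → ℝ) → ℝ}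
    (hf : LocallyIntegrable f volume) (Q : Cube n) : IntegrableOn f Q.toSet :=
  (hf.integrableOn_isCompact (isCompact_closedBall Q.corner Q.side)).mono_set
    (Q.toSet_subset_closedBall Q.corner_mem)

theorem IsWeight.aemeasurable (hw : IsWeight w) :
    AEMeasurable (fun x => ENNReal.ofReal (w x)) volume :=
  hw.2.aestronglyMeasurable.aemeasurable.ennreal_ofReal

theorem IsWeight.wMass_ne_top (hw : IsWeight w) (Q : Cube n) : wMass w Q.toSet ≠ ∞ :=
  (hw.2.integrableOn_cube Q).lintegral_lt_top.ne

theorem IsWeight.wMass_ne_zero (hw : IsWeight w) (Q : Cube n) : wMass w Q.toSet ≠ 0 := by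
  rw [wMass, Ne, lintegral_eq_zero_iff' hw.aemeasurable.restrict]
  intro h
  have h0 : ∀ᵐ x ∂volume.restrict Q.toSet, False := by
    filter_upwards [h] with x hx
    have := hw.1 x
    simp only [Pi.zero_apply, ENNReal.ofReal_eq_zero] at hx
    linarith
  rw [ae_iff] at h0
  simp only [not_false_eq_true, ofPred_true, Measure.restrict_apply_univ] at h0
  exact Q.volume_ne_zero h0

/-! ### The Fujii--Wilson constant and sparse families -/

theorem IsWeight.average_le_maximalFn (hw : IsWeight w) {P : Cube n} (hPQ : P.toSet ⊆ Q.toSet)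
    (hx : x ∈ P.toSet) :
    wMass w P.toSet / volume P.toSet ≤ maximalFn (Q.toSet.indicator w) x := by
  refine le_trans (le_of_eq ?_) (le_iSup₂ (f := fun (P : Cube n) (_ : x ∈ P.toSet) =>
    (∫⁻ y in P.toSet, ‖Q.toSet.indicator w y‖ₑ) / volume P.toSet) P hx)
  congr 1
  refine setLIntegral_congr_fun P.measurableSet_toSet fun y hy => ?_
  rw [indicator_of_mem (hPQ hy), Real.enorm_of_nonneg (hw.1 y).le]

/-- Sparseness gives `w(P) ≤ 2 (w(P)/|P|) |E_P| ≤ 2 ∫_{E_P} M(w χ_Q)`, and the sets `E_P` are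
disjoint subsets of `Q`. -/
theorem sparseConst_le_fujiiWilson (hn : 1 ≤ n) (hw : IsWeight w) :
    sparseConst (1 / 2) w ≤ 2 * fujiiWilson w := by
  refine iSup_le fun Q => iSup₂_le fun F hF => ?_
  have hFc := (countable_dyadic Q).mono hF.1
  have hsub : ∀ P ∈ F, P.toSet ⊆ Q.toSet := fun P hP => (exists_eq_cubeAt (hF.1 hP)).1
  have key : ∑' P : F, wMass w P.1.toSet ≤
      2 * ∫⁻ x in Q.toSet, maximalFn (Q.toSet.indicator w) x := by
    calc ∑' P : F, wMass w P.1.toSet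
        ≤ ∑' P : F, 2 * ∫⁻ x in exclusivePart F P.1, maximalFn (Q.toSet.indicator w) x := by
          refine ENNReal.tsum_le_tsum fun P => ?_
          calc wMass w P.1.toSet
              = wMass w P.1.toSet / volume P.1.toSet * volume P.1.toSet :=
                (ENNReal.div_mul_cancel P.1.volume_ne_zero P.1.volume_ne_top).symm
            _ ≤ wMass w P.1.toSet / volume P.1.toSet * (2 * volume (exclusivePart F P.1)) := by
                gcongr
                exact hF.volume_le P.2
            _ = 2 * ∫⁻ _ in exclusivePart F P.1, wMass w P.1.toSet / volume P.1.toSet := by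
                rw [setLIntegral_const]; ring
            _ ≤ _ := by
                gcongr 2 * ?_
                exact setLIntegral_mono' (measurableSet_exclusivePart hFc _) fun x hx =>
                  hw.average_le_maximalFn (hsub _ P.2) hx.1
      _ = 2 * ∫⁻ x in ⋃ P ∈ F, exclusivePart F P, maximalFn (Q.toSet.indicator w) x := by
          rw [ENNReal.tsum_mul_left, lintegral_biUnion hFc
            (fun P _ => measurableSet_exclusivePart hFc P) (exclusivePart_disjoint hn hF.1)]
      _ ≤ _ := by
          gcongr
          exact iUnion₂_subset fun P hP => (exclusivePart_subset F P).trans (hsub P hP)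
  calc (∑' P : F, wMass w P.1.toSet) / wMass w Q.toSet
      ≤ (2 * ∫⁻ x in Q.toSet, maximalFn (Q.toSet.indicator w) x) / wMass w Q.toSet := by gcongr
    _ = 2 * ((∫⁻ x in Q.toSet, maximalFn (Q.toSet.indicator w) x) / wMass w Q.toSet) :=
        mul_div_assoc _ _ _
    _ ≤ 2 * fujiiWilson w := by
        gcongr
        exact le_iSup (fun Q : Cube n =>
          (∫⁻ x in Q.toSet, maximalFn (Q.toSet.indicator w) x) / wMass w Q.toSet) Q

theorem mem_dyadic_self (Q : Cube n) : Q ∈ dyadic Q := by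
  simpa only [cubeAt_zero Q.corner_mem] using cubeAt_mem_dyadic (k := 0) Q.corner_mem

theorem Cube.subset_dilate (P : Cube n) (t : ℕ) : P.toSet ⊆ (P.dilate t).toSet := by
  intro x hx i
  have := hx i
  have : 0 ≤ (t : ℝ) * P.side := mul_nonneg (by positivity) P.side_pos.le
  simp only [Cube.dilate]
  push_cast
  constructor <;> linarith

theorem Cube.mem_dilate_one {P : Cube n} (hy : y ∈ P.toSet) (hxy : ∀ i, |x i - y i| < P.side) :
    x ∈ (P.dilate 1).toSet := by
  intro i
  have := hy i
  have := abs_lt.1 (hxy i)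
  simp only [Cube.dilate]
  push_cast
  constructor <;> linarith

theorem dyadicIndex_le_add_one (hxy : ∀ i, |x i - y i| ≤ Q.side / 2 ^ k) (i : Fin n) :
    dyadicIndex Q k x i ≤ dyadicIndex Q k y i + 1 := by
  have hs : 0 < Q.side / 2 ^ k := div_pos Q.side_pos (by positivity)
  rw [dyadicIndex, dyadicIndex]
  rcases le_total 0 ((y i - Q.corner i) / (Q.side / 2 ^ k)) with h0 | h0
  · rw [← Nat.floor_add_one h0]
    refine Nat.floor_mono ?_
    rw [div_add_one hs.ne']
    gcongr
    linarith [(abs_le.1 (hxy i)).2]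
  · rw [Nat.floor_of_nonpos h0]
    have : (x i - Q.corner i) / (Q.side / 2 ^ k) ≤ 1 := by
      rw [div_le_one hs]
      have h1 : y i - Q.corner i ≤ 0 := by
        by_contra! h
        exact absurd (div_pos h hs) (not_lt.2 h0)
      linarith [(abs_le.1 (hxy i)).2]
    simpa using Nat.floor_mono this

/-- The maximal function of `w` cut off to `Q` is controlled by averages over dyadic cubes whose
threefold dilates contain the point. -/
theorem maximalFn_indicator_le (hx : x ∈ Q.toSet) {B : ℝ≥0∞}
    (hB : ∀ R ∈ dyadic Q, x ∈ (R.dilate 1).toSet → wMass w R.toSet ≤ B * volume R.toSet)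
    (hw : IsWeight w) : maximalFn (Q.toSet.indicator w) x ≤ 6 ^ n * B := by
  refine iSup₂_le fun P hxP => ?_
  have hnum : ∫⁻ y in P.toSet, ‖Q.toSet.indicator w y‖ₑ = wMass w (Q.toSet ∩ P.toSet) := by
    rw [wMass, ← Measure.restrict_restrict Q.measurableSet_toSet,
      ← lintegral_indicator Q.measurableSet_toSet]
    refine lintegral_congr fun y => ?_
    by_cases hy : y ∈ Q.toSet
    · rw [indicator_of_mem hy, indicator_of_mem hy, Real.enorm_of_nonneg (hw.1 y).le]
    · rw [indicator_of_notMem hy, indicator_of_notMem hy, enorm_zero]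
  rw [hnum]
  refine ENNReal.div_le_of_le_mul ?_
  rcases le_total Q.side P.side with hle | hle
  · calc wMass w (Q.toSet ∩ P.toSet) ≤ wMass w Q.toSet := wMass_mono inter_subset_left
      _ ≤ 1 * B * volume Q.toSet := by
        rw [one_mul]; exact hB Q (mem_dyadic_self Q) (Q.subset_dilate 1 hx)
      _ ≤ 6 ^ n * B * volume P.toSet := by
        rw [Cube.volume_toSet, Cube.volume_toSet]
        gcongr
        exact one_le_pow₀ (by norm_num)
  -- Choose the generation whose side lies between `ℓ(P)` and `2ℓ(P)`. Then `Q ∩ P` meets only the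
  -- cell of `x` and its neighbours: `3^n` cells of volume at most `2^n |P|`, whence `6^n`.
  obtain ⟨k, hk1, hk2⟩ := exists_nat_pow_near (x := Q.side / P.side) (y := 2)
    ((one_le_div P.side_pos).2 hle) one_lt_two
  rw [le_div_iff₀ P.side_pos] at hk1
  rw [div_lt_iff₀ P.side_pos] at hk2
  have hPk : P.side ≤ Q.side / 2 ^ k := by
    rw [le_div_iff₀ (by positivity)]; linarith
  have hkP : Q.side / 2 ^ k ≤ 2 * P.side := by
    rw [div_le_iff₀ (by positivity)]; rw [pow_succ] at hk2; linarith
  classical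
  let S : Finset (Fin n → ℕ) := (Fintype.piFinset fun i =>
    Finset.Icc (dyadicIndex Q k x i - 1) (dyadicIndex Q k x i + 1)).filter fun m =>
      (∀ i, m i < 2 ^ k) ∧ x ∈ ((dyadicCube Q k m).dilate 1).toSet
  have hScard : S.card ≤ 3 ^ n := by
    refine (Finset.card_filter_le _ _).trans ?_
    rw [Fintype.card_piFinset]
    refine (Finset.prod_le_pow_card _ _ 3 fun i _ => ?_).trans (by simp)
    rw [Nat.card_Icc]; omega
  have hcover : Q.toSet ∩ P.toSet ⊆ ⋃ m ∈ S, (dyadicCube Q k m).toSet := by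
    rintro y ⟨hyQ, hyP⟩
    refine mem_biUnion (x := dyadicIndex Q k y) ?_ (mem_cubeAt hyQ)
    have hxy : ∀ i, |x i - y i| < Q.side / 2 ^ k := fun i =>
      (Cube.dist_lt_side hxP hyP i).trans_le hPk
    refine Finset.mem_coe.2 (Finset.mem_filter.2 ⟨?_, dyadicIndex_lt hyQ, ?_⟩)
    · refine Fintype.mem_piFinset.2 fun i => Finset.mem_Icc.2 ⟨?_, ?_⟩
      · have := dyadicIndex_le_add_one (fun i => (hxy i).le) i
        omega
      · exact dyadicIndex_le_add_one (fun i => by rw [abs_sub_comm]; exact (hxy i).le) i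
    · exact Cube.mem_dilate_one (mem_cubeAt hyQ) hxy
  have hvol : volume (cubeAt Q k x).toSet ≤ 2 ^ n * volume P.toSet := by
    rw [Cube.volume_toSet, Cube.volume_toSet, ← mul_pow, cubeAt_side]
    gcongr
    refine (ENNReal.ofReal_le_ofReal hkP).trans (le_of_eq ?_)
    rw [ENNReal.ofReal_mul two_pos.le, ENNReal.ofReal_ofNat]
  calc wMass w (Q.toSet ∩ P.toSet)
      ≤ wMass w (⋃ m ∈ S, (dyadicCube Q k m).toSet) := wMass_mono hcover
    _ ≤ ∑ m ∈ S, wMass w (dyadicCube Q k m).toSet := by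
        rw [← weightMeasure_apply _
          (Finset.measurableSet_biUnion _ fun m _ => Cube.measurableSet_toSet _)]
        refine (measure_biUnion_finset_le _ _).trans (le_of_eq ?_)
        exact Finset.sum_congr rfl fun m _ => weightMeasure_apply _ (Cube.measurableSet_toSet _)
    _ ≤ ∑ m ∈ S, B * volume (cubeAt Q k x).toSet := by
        refine Finset.sum_le_sum fun m hm => ?_
        obtain ⟨-, hm1, hm2⟩ := Finset.mem_filter.1 hm
        refine (hB _ (mem_dyadic_iff.2 ⟨k, m, hm1, rfl⟩) hm2).trans (le_of_eq ?_)
        rw [Cube.volume_toSet, Cube.volume_toSet]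
        rfl
    _ = S.card * (B * volume (cubeAt Q k x).toSet) := by
        rw [Finset.sum_const, nsmul_eq_mul]
    _ ≤ (3 ^ n : ℕ) * (B * (2 ^ n * volume P.toSet)) := by
        gcongr
    _ = 6 ^ n * B * volume P.toSet := by
        rw [show (6 : ℝ≥0∞) = 3 * 2 by norm_num, mul_pow]
        push_cast
        ring

theorem tsum_wMass_le_sparseConst (hw : IsWeight w) {F : Set (Cube n)}
    (hF : IsSparse (1 / 2) Q F) :
    ∑' P : F, wMass w P.1.toSet ≤ sparseConst (1 / 2) w * wMass w Q.toSet := by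
  rw [← ENNReal.div_le_iff (hw.wMass_ne_zero Q) (hw.wMass_ne_top Q)]
  exact le_iSup_of_le Q (le_iSup₂_of_le F hF le_rfl)

/-- The principal cubes of `w`. -/
theorem IsWeight.isSparse_principal (hw : IsWeight w) (Q : Cube n) :
    IsSparse (1 / 2) Q (stopFamily Q fun P R =>
      2 * wMass w P.toSet * volume R.toSet < wMass w R.toSet * volume P.toSet) := by
  refine isSparse_stopFamily fun P hP => ?_
  have h0 : 2 * wMass w P.toSet ≠ 0 := mul_ne_zero (by simp) (hw.wMass_ne_zero P)
  have ht : 2 * wMass w P.toSet ≠ ∞ := ENNReal.mul_ne_top (by simp) (hw.wMass_ne_top P)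
  -- The weight is normalised to give `P` mass `|P|/2`; selection of `R` then says that its mass
  -- exceeds `|R|`.
  refine ⟨(volume P.toSet / (2 * wMass w P.toSet)) • weightMeasure w, ?_, fun R hR hRP hs => ?_⟩
  · rw [Measure.smul_apply, weightMeasure_apply _ P.measurableSet_toSet, smul_eq_mul,
      mul_left_comm, ENNReal.div_mul_cancel h0 ht]
  · rw [Measure.smul_apply, weightMeasure_apply _ R.measurableSet_toSet, smul_eq_mul,
      ← ENNReal.mul_div_right_comm, ENNReal.le_div_iff_mul_le (Or.inl h0) (Or.inl ht),
      mul_comm, mul_comm (volume P.toSet)]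
    exact hs.le

/-- If `x ∈ 3R`, the last principal cube `T ⊇ R` satisfies `x ∈ 3T` and has at least half the
average of `R`. So the maximal function is at most `2 · 6^n` times the sum of `w(P)/|P|` over
principal `P` with `x ∈ 3P`; integrating over `3P` costs a further `3^n`. -/
theorem fujiiWilson_le_sparseConst (hw : IsWeight w) :
    fujiiWilson w ≤ 2 * 18 ^ n * sparseConst (1 / 2) w := by
  refine iSup_le fun Q => ENNReal.div_le_of_le_mul ?_
  have hsparse := hw.isSparse_principal Q
  set sel : Cube n → Cube n → Prop := fun P R =>
    2 * wMass w P.toSet * volume R.toSet < wMass w R.toSet * volume P.toSet with hsel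
  set F := stopFamily Q sel
  have hFc : F.Countable := (countable_dyadic Q).mono hsparse.1
  have := hFc.to_subtype
  let a : Cube n → ℝ≥0∞ := fun P => wMass w P.toSet / volume P.toSet
  let S : (Fin n → ℝ) → ℝ≥0∞ := fun x =>
    ∑' P : F, (P.1.dilate 1).toSet.indicator (fun _ => a P) x
  have hrefl : ∀ P ∈ dyadic Q, ¬ sel P P := fun P _ => by
    simp only [hsel, not_lt]
    gcongr
    exact le_mul_of_one_le_left' one_le_two
  have hpt : ∀ x ∈ Q.toSet, maximalFn (Q.toSet.indicator w) x ≤ 6 ^ n * (2 * S x) := by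
    refine fun x hx => maximalFn_indicator_le hx (fun R hR hxR => ?_) hw
    obtain ⟨hRQ, k, -, hk⟩ := exists_eq_cubeAt hR
    have hk := hk _ R.corner_mem
    set z := R.corner
    have hz : z ∈ Q.toSet := hRQ R.corner_mem
    set T := cubeAt Q (stopGen Q sel k z) z
    have hns : ¬ sel T R := by
      have := not_stop_cubeAt hrefl hz k
      rwa [← hk] at this
    have hRT : R.toSet ⊆ T.toSet := by
      conv_lhs => rw [hk]
      exact cubeAt_subset_cubeAt (stopGen_le k z)
    have hside : R.side ≤ T.side := by
      conv_lhs => rw [hk]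
      exact (strictAnti_side Q).antitone (stopGen_le k z)
    have hTF : T ∈ F := cubeAt_stopGen_mem hz
    have hS : a T ≤ S x := by
      refine le_trans (le_of_eq ?_) (ENNReal.le_tsum (⟨T, hTF⟩ : F))
      rw [indicator_of_mem (Cube.dilate_subset_dilate hside hRT 1 hxR)]
    have h1 : wMass w R.toSet * volume T.toSet ≤ 2 * wMass w T.toSet * volume R.toSet :=
      not_lt.1 hns
    calc wMass w R.toSet
        ≤ 2 * wMass w T.toSet * volume R.toSet / volume T.toSet := by
          rwa [ENNReal.le_div_iff_mul_le (Or.inl T.volume_ne_zero) (Or.inl T.volume_ne_top)]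
      _ = 2 * a T * volume R.toSet := by
          simp only [a, div_eq_mul_inv]; ring
      _ ≤ 2 * S x * volume R.toSet := by gcongr
  calc ∫⁻ x in Q.toSet, maximalFn (Q.toSet.indicator w) x
      ≤ ∫⁻ x in Q.toSet, 6 ^ n * (2 * S x) := setLIntegral_mono' Q.measurableSet_toSet hpt
    _ ≤ ∫⁻ x, 6 ^ n * (2 * S x) := setLIntegral_le_lintegral _ _
    _ = 6 ^ n * (2 * ∫⁻ x, S x) := by
        rw [lintegral_const_mul' _ _ (by finiteness), lintegral_const_mul' _ _ (by simp)]
    _ = 6 ^ n * (2 * ∑' P : F, 3 ^ n * wMass w P.1.toSet) := by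
        congr 2
        rw [lintegral_tsum fun P => (measurable_const.indicator
          (Cube.measurableSet_toSet _)).aemeasurable]
        refine tsum_congr fun P => ?_
        rw [lintegral_indicator_const (Cube.measurableSet_toSet _), Cube.volume_dilate,
          mul_left_comm, ENNReal.div_mul_cancel P.1.volume_ne_zero P.1.volume_ne_top]
        norm_num
    _ = 2 * 18 ^ n * ∑' P : F, wMass w P.1.toSet := by
        rw [ENNReal.tsum_mul_left, show (18 : ℝ≥0∞) = 6 * 3 by norm_num, mul_pow]
        ring
    _ ≤ 2 * 18 ^ n * (sparseConst (1 / 2) w * wMass w Q.toSet) := by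
        gcongr
        exact tsum_wMass_le_sparseConst hw hsparse
    _ = _ := by ring

/-! ### Mean oscillation -/

variable {f : (Fin n → ℝ) → ℝ}

theorem enorm_mean_sub_mul_volume_le (hf : LocallyIntegrable f volume) (Q : Cube n) (c : ℝ) :
    ‖mean f Q - c‖ₑ * volume Q.toSet ≤ ∫⁻ x in Q.toSet, ‖f x - c‖ₑ := by
  have hreal : volume.real Q.toSet ≠ 0 :=
    (ENNReal.toReal_pos Q.volume_ne_zero Q.volume_ne_top).ne'
  have hint : IntegrableOn (fun _ => c) Q.toSet volume :=
    integrableOn_const Q.volume_ne_top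
  have h : ∫ x in Q.toSet, (f x - c) = (mean f Q - c) * volume.real Q.toSet := by
    rw [integral_sub (hf.integrableOn_cube Q) hint, mean, setAverage_eq, setIntegral_const,
      smul_eq_mul, smul_eq_mul]
    field_simp
  have h2 : ‖(mean f Q - c) * volume.real Q.toSet‖ₑ = ‖mean f Q - c‖ₑ * volume Q.toSet := by
    rw [enorm_mul, Real.enorm_of_nonneg measureReal_nonneg, ofReal_measureReal Q.volume_ne_top]
  rw [← h2, ← h]
  exact enorm_integral_le_lintegral_enorm _

theorem enorm_mean_sub_le (hf : LocallyIntegrable f volume) {c : ℝ} {A : ℝ≥0∞}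
    (h : ∫⁻ x in Q.toSet, ‖f x - c‖ₑ ≤ A * volume Q.toSet) : ‖mean f Q - c‖ₑ ≤ A := by
  have := (enorm_mean_sub_mul_volume_le hf Q c).trans h
  exact (ENNReal.mul_le_mul_iff_left Q.volume_ne_zero Q.volume_ne_top).1 this

theorem lintegral_sub_mean_le_of_bmoNorm_le {A : ℝ≥0∞} (h : bmoNorm f ≤ A) (Q : Cube n) :
    ∫⁻ x in Q.toSet, ‖f x - mean f Q‖ₑ ≤ A * volume Q.toSet := by
  rw [← ENNReal.div_le_iff Q.volume_ne_zero Q.volume_ne_top]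
  exact (le_iSup (fun Q : Cube n =>
    (∫⁻ x in Q.toSet, ‖f x - mean f Q‖ₑ) / volume Q.toSet) Q).trans h

/-- To bound the `BMO` norm, the means may be replaced by arbitrary constants. -/
theorem bmoNorm_le_of_forall_exists (hf : LocallyIntegrable f volume) {A : ℝ≥0∞}
    (h : ∀ Q : Cube n, ∃ c : ℝ, ∫⁻ x in Q.toSet, ‖f x - c‖ₑ ≤ A * volume Q.toSet) :
    bmoNorm f ≤ 2 * A := by
  refine iSup_le fun Q => ENNReal.div_le_of_le_mul ?_
  obtain ⟨c, hc⟩ := h Q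
  calc ∫⁻ x in Q.toSet, ‖f x - mean f Q‖ₑ
      ≤ ∫⁻ x in Q.toSet, (‖f x - c‖ₑ + ‖mean f Q - c‖ₑ) := by
        refine lintegral_mono fun x => ?_
        rw [← sub_sub_sub_cancel_right (f x) (mean f Q) c]
        exact enorm_sub_le
    _ = (∫⁻ x in Q.toSet, ‖f x - c‖ₑ) + ‖mean f Q - c‖ₑ * volume Q.toSet := by
        rw [lintegral_add_right _ measurable_const, setLIntegral_const]
    _ ≤ A * volume Q.toSet + A * volume Q.toSet := by
        gcongr
        exact enorm_mean_sub_le hf hc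
    _ = 2 * A * volume Q.toSet := by ring

theorem mean_const_mul (c : ℝ) (f : (Fin n → ℝ) → ℝ) (Q : Cube n) :
    mean (fun x => c * f x) Q = c * mean f Q := by
  rw [mean, mean, setAverage_eq, setAverage_eq, integral_const_mul, smul_eq_mul, smul_eq_mul]
  ring

theorem bmoNorm_const_mul_le (c : ℝ) (f : (Fin n → ℝ) → ℝ) :
    bmoNorm (fun x => c * f x) ≤ ‖c‖ₑ * bmoNorm f := by
  refine iSup_le fun Q => ENNReal.div_le_of_le_mul ?_
  simp only [mean_const_mul, ← mul_sub, enorm_mul]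
  rw [lintegral_const_mul' _ _ enorm_ne_top, mul_assoc]
  gcongr
  exact lintegral_sub_mean_le_of_bmoNorm_le le_rfl Q

theorem lintegral_sub_mean_mul_weight_le (hw : IsWeight w) (hf : LocallyIntegrable f volume)
    (hbmo : bmoNorm f ≤ 1) (Q : Cube n) :
    ∫⁻ x in Q.toSet, ‖f x - mean f Q‖ₑ * ENNReal.ofReal (w x) ≤
      bmoEmbeddingConst w * wMass w Q.toSet := by
  rw [← ENNReal.div_le_iff (hw.wMass_ne_zero Q) (hw.wMass_ne_top Q)]
  refine le_iSup_of_le f (le_iSup₂_of_le hf hbmo ?_)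
  exact le_iSup (fun Q : Cube n => (∫⁻ x in Q.toSet, ‖f x - mean f Q‖ₑ * ENNReal.ofReal (w x)) /
    wMass w Q.toSet) Q

theorem lintegral_sub_mean_mul_weight_le_of_bmoNorm_le (hw : IsWeight w)
    (hf : LocallyIntegrable f volume) {A : ℝ} (hA : 0 < A) (hbmo : bmoNorm f ≤ ENNReal.ofReal A)
    (Q : Cube n) :
    ∫⁻ x in Q.toSet, ‖f x - mean f Q‖ₑ * ENNReal.ofReal (w x) ≤
      ENNReal.ofReal A * bmoEmbeddingConst w * wMass w Q.toSet := by
  have hA0 : ENNReal.ofReal A ≠ 0 := by simpa using hA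
  have hinv : ‖A⁻¹‖ₑ = (ENNReal.ofReal A)⁻¹ := by
    rw [Real.enorm_of_nonneg (inv_pos.2 hA).le, ENNReal.ofReal_inv_of_pos hA]
  have h1 : bmoNorm (fun x => A⁻¹ * f x) ≤ 1 := by
    refine (bmoNorm_const_mul_le _ f).trans ?_
    rw [hinv]
    calc (ENNReal.ofReal A)⁻¹ * bmoNorm f ≤ (ENNReal.ofReal A)⁻¹ * ENNReal.ofReal A := by gcongr
      _ = 1 := ENNReal.inv_mul_cancel hA0 ENNReal.ofReal_ne_top
  have h2 := lintegral_sub_mean_mul_weight_le hw (hf.smul A⁻¹) h1 Q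
  change ∫⁻ x in Q.toSet, ‖A⁻¹ * f x - mean (fun x => A⁻¹ * f x) Q‖ₑ * _ ≤ _ at h2
  simp only [mean_const_mul, ← mul_sub, enorm_mul, mul_assoc, hinv] at h2
  rw [lintegral_const_mul' _ _ (by simpa using hA), ENNReal.inv_mul_le_iff hA0
    ENNReal.ofReal_ne_top] at h2
  rwa [mul_assoc]

/-- The embedding constant is bounded from below: test with the indicator of a dyadic child. -/
theorem one_le_bmoEmbeddingConst (hn : 1 ≤ n) (hw : IsWeight w) :
    1 ≤ 2 ^ n * bmoEmbeddingConst w := by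
  let Q : Cube n := ⟨0, 1, one_pos⟩
  have hQ : (0 : Fin n → ℝ) ∈ Q.toSet := Q.corner_mem
  let P := cubeAt Q 1 0
  let f : (Fin n → ℝ) → ℝ := P.toSet.indicator fun _ => 1
  have hf01 : ∀ x, 0 ≤ f x ∧ f x ≤ 1 := fun x =>
    ⟨indicator_nonneg (fun _ _ => zero_le_one) x,
      indicator_le_self' (fun _ _ => zero_le_one) x⟩
  have hint : Integrable f volume :=
    (integrableOn_const P.volume_ne_top).integrable_indicator P.measurableSet_toSet
  have hf : LocallyIntegrable f volume := hint.locallyIntegrable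
  have hmean01 : ∀ R : Cube n, 0 ≤ mean f R ∧ mean f R ≤ 1 := by
    intro R
    have hpos : 0 < volume.real R.toSet := ENNReal.toReal_pos R.volume_ne_zero R.volume_ne_top
    rw [mean, setAverage_eq, smul_eq_mul]
    refine ⟨mul_nonneg (inv_nonneg.2 hpos.le) (integral_nonneg fun x => (hf01 x).1), ?_⟩
    rw [inv_mul_le_iff₀ hpos, mul_one]
    calc ∫ x in R.toSet, f x ≤ ∫ _ in R.toSet, (1 : ℝ) :=
          integral_mono hint.integrableOn (integrableOn_const R.volume_ne_top) fun x => (hf01 x).2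
      _ = volume.real R.toSet := by simp
  have hbmo : bmoNorm f ≤ 1 := by
    refine iSup_le fun R => ENNReal.div_le_of_le_mul ?_
    calc ∫⁻ x in R.toSet, ‖f x - mean f R‖ₑ ≤ ∫⁻ _ in R.toSet, 1 := by
          refine lintegral_mono fun x => ?_
          rw [Real.enorm_eq_ofReal_abs, ← ENNReal.ofReal_one]
          refine ENNReal.ofReal_le_ofReal (abs_le.2 ?_)
          have := hf01 x; have := hmean01 R
          constructor <;> linarith
      _ = 1 * volume R.toSet := by rw [setLIntegral_const]
  have hreal : (2 : ℝ) ^ n * volume.real P.toSet = volume.real Q.toSet := by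
    have := congrArg ENNReal.toReal (volume_cubeAt (Q := Q) (x := 0) 1)
    rw [ENNReal.toReal_mul, one_mul] at this
    simpa [Measure.real] using this
  have hmean : mean f Q = (2 ^ n)⁻¹ := by
    have hpos : 0 < volume.real Q.toSet := ENNReal.toReal_pos Q.volume_ne_zero Q.volume_ne_top
    rw [mean, setAverage_eq, setIntegral_indicator P.measurableSet_toSet,
      inter_eq_self_of_subset_right (cubeAt_subset hQ)]
    simp only [integral_const, smul_eq_mul, mul_one, measureReal_restrict_apply_univ]
    rw [← hreal] at hpos ⊢
    have : volume.real P.toSet ≠ 0 := fun h => by simp [h] at hpos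
    field_simp
    rfl
  have h2n : (2 : ℝ) ≤ 2 ^ n := by
    calc (2 : ℝ) = 2 ^ 1 := by norm_num
      _ ≤ 2 ^ n := pow_le_pow_right₀ (by norm_num) hn
  have hinv : ((2 : ℝ) ^ n)⁻¹ ≤ 2⁻¹ := inv_anti₀ two_pos h2n
  have hinv0 : 0 < ((2 : ℝ) ^ n)⁻¹ := by positivity
  -- As `2^(-n) ≤ 1/2`, both values `0` and `1` of `f` are at least `2^(-n)` away from the mean, so
  -- the bound holds whatever the weight.
  have hlow : ∀ x, ((2 : ℝ≥0∞) ^ n)⁻¹ ≤ ‖f x - mean f Q‖ₑ := by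
    intro x
    have h : ((2 : ℝ≥0∞) ^ n)⁻¹ = ENNReal.ofReal ((2 ^ n)⁻¹) := by
      rw [ENNReal.ofReal_inv_of_pos (by positivity), ENNReal.ofReal_pow two_pos.le,
        ENNReal.ofReal_ofNat]
    rw [h, hmean, Real.enorm_eq_ofReal_abs]
    refine ENNReal.ofReal_le_ofReal ?_
    by_cases hx : x ∈ P.toSet
    · simp only [f, indicator_of_mem hx]
      refine le_trans ?_ (le_abs_self _)
      norm_num at hinv ⊢
      linarith
    · simp only [f, indicator_of_notMem hx, zero_sub, abs_neg]
      exact le_abs_self _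
  have hfin := (lintegral_mono fun x => mul_le_mul_left (hlow x) (ENNReal.ofReal (w x))).trans
    (lintegral_sub_mean_mul_weight_le hw hf hbmo Q)
  rw [lintegral_const_mul' _ _ (by simp)] at hfin
  have hfin := (ENNReal.mul_le_mul_iff_left (hw.wMass_ne_zero Q) (hw.wMass_ne_top Q)).1 hfin
  calc (1 : ℝ≥0∞) = 2 ^ n * (2 ^ n)⁻¹ := (ENNReal.mul_inv_cancel (by simp) (by simp)).symm
    _ ≤ _ := by gcongr

/-! ### Functions of bounded mean oscillation from sparse families -/

variable {F : Set (Cube n)}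

/-- Converts a count of generations into a sum over a family of cubes. -/
theorem card_le_tsum_of_injOn (T : Finset ℕ) (G : Set (Cube n)) (h : Cube n → ℝ≥0∞)
    (P : ℕ → Cube n) (hP : ∀ k ∈ T, P k ∈ G ∧ 1 ≤ h (P k)) (hinj : InjOn P T) :
    (T.card : ℝ≥0∞) ≤ ∑' R : G, h R := by
  classical
  calc (T.card : ℝ≥0∞) = ∑ k ∈ T, 1 := by simp
    _ ≤ ∑ k ∈ T, G.indicator h (P k) := Finset.sum_le_sum fun k hk => by
        rw [indicator_of_mem (hP k hk).1]; exact (hP k hk).2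
    _ = ∑ R ∈ T.image P, G.indicator h R := (Finset.sum_image hinj).symm
    _ ≤ ∑' R, G.indicator h R := ENNReal.sum_le_tsum _
    _ = ∑' R : G, h R := (tsum_subtype G h).symm

/-- The cubes of `F` of generation `k`. -/
def layer (F : Set (Cube n)) (Q : Cube n) (k : ℕ) : Set (Cube n) :=
  {P ∈ F | P.side = Q.side / 2 ^ k}

theorem side_div_pos (Q : Cube n) (k : ℕ) : 0 < Q.side / 2 ^ k :=
  div_pos Q.side_pos (by positivity)

/-- A Lipschitz function which is `1` on the cubes of `F` of generation `k`, and vanishes off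
their threefold dilates. -/
def bump (F : Set (Cube n)) (Q : Cube n) (k : ℕ) (x : Fin n → ℝ) : ℝ :=
  thickenedIndicator (side_div_pos Q k) (⋃ P ∈ layer F Q k, P.toSet) x

theorem bump_nonneg : 0 ≤ bump F Q k x := NNReal.coe_nonneg _

theorem bump_le_one : bump F Q k x ≤ 1 :=
  NNReal.coe_le_one.2 (thickenedIndicator_le_one _ _ _)

theorem bump_eq_one (h : x ∈ ⋃ P ∈ layer F Q k, P.toSet) : bump F Q k x = 1 := by
  rw [bump, thickenedIndicator_one _ _ h, NNReal.coe_one]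

theorem continuous_bump : Continuous (bump F Q k) :=
  NNReal.continuous_coe.comp (thickenedIndicator _ _).continuous

theorem exists_of_bump_ne_zero (h : bump F Q k x ≠ 0) :
    ∃ P ∈ layer F Q k, x ∈ (P.dilate 1).toSet := by
  have hx : x ∈ Metric.thickening (Q.side / 2 ^ k) (⋃ P ∈ layer F Q k, P.toSet) := by
    by_contra hx
    exact h (by rw [bump, thickenedIndicator_zero _ _ hx, NNReal.coe_zero])
  obtain ⟨y, hy, hxy⟩ := Metric.mem_thickening_iff.1 hx
  simp only [mem_iUnion, exists_prop] at hy
  obtain ⟨P, hP, hyP⟩ := hy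
  refine ⟨P, hP, Cube.mem_dilate_one hyP fun i => ?_⟩
  rw [hP.2]
  exact (dist_le_pi_dist x y i).trans_lt hxy

theorem abs_bump_sub_le {R : Cube n} (hx : x ∈ R.toSet) (hy : y ∈ R.toSet) :
    |bump F Q k x - bump F Q k y| ≤ R.side / Q.side * 2 ^ k := by
  have h := (lipschitzWith_thickenedIndicator (side_div_pos Q k)
    (⋃ P ∈ layer F Q k, P.toSet)).dist_le_mul x y
  rw [NNReal.dist_eq] at h
  refine h.trans ?_
  have hd : dist x y ≤ R.side := R.toSet_subset_closedBall hy hx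
  rw [NNReal.coe_inv, Real.coe_toNNReal _ (side_div_pos Q k).le, inv_div]
  calc 2 ^ k / Q.side * dist x y ≤ 2 ^ k / Q.side * R.side := by
        have := Q.side_pos
        gcongr
    _ = _ := by ring

/-- A geometric sum is at most twice its largest term. This adds up the Lipschitz constants of the
coarse bumps. -/
theorem sum_two_pow_le (K : ℕ) {t : ℝ} (ht : 0 ≤ t) :
    ∑ k ∈ (Finset.range K).filter (fun k => (2 : ℝ) ^ k ≤ t), (2 : ℝ) ^ k ≤ 2 * t := by
  induction K with
  | zero => simpa using ht
  | succ K ih =>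
    by_cases h : (2 : ℝ) ^ K ≤ t
    · calc ∑ k ∈ (Finset.range (K + 1)).filter (fun k => (2 : ℝ) ^ k ≤ t), (2 : ℝ) ^ k
          ≤ ∑ k ∈ Finset.range (K + 1), (2 : ℝ) ^ k :=
            Finset.sum_le_sum_of_subset_of_nonneg (Finset.filter_subset _ _)
              fun _ _ _ => by positivity
        _ ≤ 2 ^ (K + 1) := by
            rw [geom_sum_eq (by norm_num)]
            norm_num
        _ ≤ 2 * t := by rw [pow_succ]; linarith
    · rwa [Finset.range_add_one, Finset.filter_insert, if_neg h]

/-- The superposition of the bumps of the first `K` generations. -/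
def bumpSum (F : Set (Cube n)) (Q : Cube n) (K : ℕ) (x : Fin n → ℝ) : ℝ :=
  ∑ k ∈ Finset.range K, bump F Q k x

theorem continuous_bumpSum {K : ℕ} : Continuous (bumpSum F Q K) :=
  continuous_finsetSum _ fun _ _ => continuous_bump

/-- Each bump alive at `x` comes from some `P ∈ F` with `x ∈ 3P`; being smaller than `R`, this `P`
lies in `5R`. Different generations give different cubes. -/
theorem sum_enorm_bump_le {R : Cube n} (hx : x ∈ R.toSet) (T : Finset ℕ)
    (hT : ∀ k ∈ T, Q.side / 2 ^ k < R.side) :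
    ∑ k ∈ T, ‖bump F Q k x‖ₑ ≤ ∑' P : {P ∈ F | P.toSet ⊆ (R.dilate 2).toSet},
      (P.1.dilate 1).toSet.indicator 1 x := by
  classical
  have hex : ∀ k, ∃ P : Cube n, bump F Q k x ≠ 0 → P ∈ layer F Q k ∧ x ∈ (P.dilate 1).toSet := by
    intro k
    by_cases h : bump F Q k x = 0
    · exact ⟨Q, fun h' => absurd h h'⟩
    · obtain ⟨P, hP⟩ := exists_of_bump_ne_zero h
      exact ⟨P, fun _ => hP⟩
  choose P hP using hex
  set T' := T.filter fun k => bump F Q k x ≠ 0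
  have hPT : ∀ k ∈ T', k ∈ T ∧ P k ∈ layer F Q k ∧ x ∈ ((P k).dilate 1).toSet := fun k hk =>
    ⟨(Finset.mem_filter.1 hk).1, hP k (Finset.mem_filter.1 hk).2⟩
  have h1 : ∑ k ∈ T, ‖bump F Q k x‖ₑ ≤ T'.card := by
    calc ∑ k ∈ T, ‖bump F Q k x‖ₑ = ∑ k ∈ T', ‖bump F Q k x‖ₑ := by
          refine (Finset.sum_subset (Finset.filter_subset _ _) fun k hk hk' => ?_).symm
          have : bump F Q k x = 0 := by
            by_contra h
            exact hk' (Finset.mem_filter.2 ⟨hk, h⟩)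
          rw [this, enorm_zero]
      _ ≤ ∑ k ∈ T', 1 := Finset.sum_le_sum fun k _ => by
          rw [Real.enorm_of_nonneg bump_nonneg, ← ENNReal.ofReal_one]
          exact ENNReal.ofReal_le_ofReal bump_le_one
      _ = T'.card := by simp
  refine h1.trans (card_le_tsum_of_injOn T' _ (fun P => (P.dilate 1).toSet.indicator 1 x) P
    (fun k hk => ?_) fun k hk l hl hkl => ?_)
  · obtain ⟨hkT, hl, hxP⟩ := hPT k hk
    refine ⟨⟨hl.1, fun y hy i => ?_⟩, ?_⟩
    · have hs : (P k).side < R.side := hl.2 ▸ hT k hkT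
      have h1 := hxP i
      have h2 := hy i
      have h3 := hx i
      simp only [Cube.dilate] at h1 ⊢
      push_cast at h1 ⊢
      constructor <;> linarith
    · rw [indicator_of_mem hxP]; rfl
  · have hk := (hPT k hk).2.1.2
    have hl := (hPT l hl).2.1.2
    rw [hkl, hl] at hk
    exact ((strictAnti_side Q).injective hk).symm

theorem lintegral_sum_enorm_bump_le (hn : 1 ≤ n) (hF : IsSparse (1 / 2) Q F) (R : Cube n)
    (T : Finset ℕ) (hT : ∀ k ∈ T, Q.side / 2 ^ k < R.side) :
    ∫⁻ x in R.toSet, ∑ k ∈ T, ‖bump F Q k x‖ₑ ≤ 2 * 15 ^ n * volume R.toSet := by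
  set G := {P ∈ F | P.toSet ⊆ (R.dilate 2).toSet}
  have := (((countable_dyadic Q).mono hF.1).mono (sep_subset _ _ : G ⊆ F)).to_subtype
  calc ∫⁻ x in R.toSet, ∑ k ∈ T, ‖bump F Q k x‖ₑ
      ≤ ∫⁻ x in R.toSet, ∑' P : G, (P.1.dilate 1).toSet.indicator 1 x :=
        setLIntegral_mono' R.measurableSet_toSet fun x hx => sum_enorm_bump_le hx T hT
    _ ≤ ∫⁻ x, ∑' P : G, (P.1.dilate 1).toSet.indicator 1 x := setLIntegral_le_lintegral _ _
    _ = ∑' P : G, 3 ^ n * volume P.1.toSet := by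
        rw [lintegral_tsum fun P => (measurable_one.indicator
          (Cube.measurableSet_toSet _)).aemeasurable]
        refine tsum_congr fun P => ?_
        rw [lintegral_indicator_one (Cube.measurableSet_toSet _), Cube.volume_dilate]
        norm_num
    _ ≤ 3 ^ n * (2 * volume (R.dilate 2).toSet) := by
        rw [ENNReal.tsum_mul_left]
        gcongr
        exact hF.tsum_volume_le hn (sep_subset _ _) fun P hP => hP.2
    _ = 2 * 15 ^ n * volume R.toSet := by
        rw [Cube.volume_dilate, show (15 : ℝ≥0∞) = 3 * 5 by norm_num, mul_pow]
        norm_num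
        ring

/-- The generations are split at the scale of `R`. The coarse bumps together vary by at most `2` on
`R`, and `c` is their sum at the corner; the fine ones have integral at most `2 · 15^n |R|`. The
bounds on `c` serve for `R = Q`, where they control the mean. -/
theorem exists_lintegral_bumpSum_sub_le (hn : 1 ≤ n) (hF : IsSparse (1 / 2) Q F) (K : ℕ)
    (R : Cube n) : ∃ c : ℝ, 0 ≤ c ∧ c ≤ 2 * (Q.side / R.side) ∧
      ∫⁻ x in R.toSet, ‖bumpSum F Q K x - c‖ₑ ≤ (2 + 2 * 15 ^ n) * volume R.toSet := by
  set t := Q.side / R.side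
  have ht : 0 < t := div_pos Q.side_pos R.side_pos
  set A := (Finset.range K).filter fun k => (2 : ℝ) ^ k ≤ t
  set T := (Finset.range K).filter fun k => ¬ (2 : ℝ) ^ k ≤ t
  have hT : ∀ k ∈ T, Q.side / 2 ^ k < R.side := fun k hk => by
    have := (Finset.mem_filter.1 hk).2
    rw [not_le, div_lt_iff₀ R.side_pos] at this
    rw [div_lt_iff₀ (by positivity)]
    linarith
  set z := R.corner
  refine ⟨∑ k ∈ A, bump F Q k z, Finset.sum_nonneg fun _ _ => bump_nonneg, ?_, ?_⟩
  · refine le_trans (Finset.sum_le_sum fun k _ => ?_) (sum_two_pow_le K ht.le)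
    exact bump_le_one.trans (one_le_pow₀ (by norm_num))
  have hpt : ∀ x ∈ R.toSet, ‖bumpSum F Q K x - ∑ k ∈ A, bump F Q k z‖ₑ ≤
      2 + ∑ k ∈ T, ‖bump F Q k x‖ₑ := by
    intro x hx
    have hsplit : bumpSum F Q K x = ∑ k ∈ A, bump F Q k x + ∑ k ∈ T, bump F Q k x :=
      (Finset.sum_filter_add_sum_filter_not _ _ _).symm
    rw [hsplit, add_sub_right_comm]
    refine (enorm_add_le _ _).trans (add_le_add ?_ (enorm_sum_le _ _))
    rw [← Finset.sum_sub_distrib, Real.enorm_eq_ofReal_abs, ← ENNReal.ofReal_ofNat]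
    refine ENNReal.ofReal_le_ofReal ?_
    calc |∑ k ∈ A, (bump F Q k x - bump F Q k z)|
        ≤ ∑ k ∈ A, |bump F Q k x - bump F Q k z| := Finset.abs_sum_le_sum_abs _ _
      _ ≤ ∑ k ∈ A, R.side / Q.side * 2 ^ k :=
          Finset.sum_le_sum fun k _ => abs_bump_sub_le hx R.corner_mem
      _ ≤ R.side / Q.side * (2 * t) := by
          rw [← Finset.mul_sum]
          have := Q.side_pos
          have := R.side_pos
          gcongr
          exact sum_two_pow_le K ht.le
      _ = 2 := by
          have := Q.side_pos.ne'
          have := R.side_pos.ne'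
          simp only [t]
          field_simp
  calc ∫⁻ x in R.toSet, ‖bumpSum F Q K x - ∑ k ∈ A, bump F Q k z‖ₑ
      ≤ ∫⁻ x in R.toSet, (2 + ∑ k ∈ T, ‖bump F Q k x‖ₑ) :=
        setLIntegral_mono' R.measurableSet_toSet hpt
    _ = 2 * volume R.toSet + ∫⁻ x in R.toSet, ∑ k ∈ T, ‖bump F Q k x‖ₑ := by
        rw [lintegral_add_left measurable_const, setLIntegral_const]
    _ ≤ 2 * volume R.toSet + 2 * 15 ^ n * volume R.toSet := by
        gcongr
        exact lintegral_sum_enorm_bump_le hn hF R T hT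
    _ = _ := by ring

/-- The left side is at most `∫_Q f w` for the bump sum `f`, hence at most its weighted oscillation
plus `|⟨f⟩_Q| w(Q)`. The second term is absorbed because the embedding constant is at least
`2^(-n)`. The bound does not depend on `K`. -/
theorem sum_wMass_layer_le (hn : 1 ≤ n) (hw : IsWeight w) (hF : IsSparse (1 / 2) Q F) (K : ℕ) :
    ∑ k ∈ Finset.range K, ∑' P : layer F Q k, wMass w P.1.toSet ≤
      (8 + 6 * 15 ^ n) * 2 ^ n * bmoEmbeddingConst w * wMass w Q.toSet := by
  set f := bumpSum F Q K
  have hf : LocallyIntegrable f volume := continuous_bumpSum.locallyIntegrable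
  have hbmo : bmoNorm f ≤ 2 * (2 + 2 * 15 ^ n) :=
    bmoNorm_le_of_forall_exists hf fun R => by
      obtain ⟨c, -, -, hc⟩ := exists_lintegral_bumpSum_sub_le hn hF K R
      exact ⟨c, hc⟩
  have hA : ENNReal.ofReal (2 * (2 + 2 * 15 ^ n)) = 2 * (2 + 2 * 15 ^ n) := by
    rw [ENNReal.ofReal_mul (by norm_num), ENNReal.ofReal_add (by norm_num) (by positivity),
      ENNReal.ofReal_mul (by norm_num), ENNReal.ofReal_pow (by norm_num)]
    simp
  have hosc := lintegral_sub_mean_mul_weight_le_of_bmoNorm_le hw hf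
    (A := 2 * (2 + 2 * 15 ^ n)) (by positivity) (hA ▸ hbmo) Q
  rw [hA] at hosc
  have hmean : ‖mean f Q‖ₑ ≤ 4 + 2 * 15 ^ n := by
    obtain ⟨c, hc0, hc1, hc⟩ := exists_lintegral_bumpSum_sub_le hn hF K Q
    rw [div_self Q.side_pos.ne'] at hc1
    have h1 := enorm_mean_sub_le hf hc
    calc ‖mean f Q‖ₑ = ‖(mean f Q - c) + c‖ₑ := by rw [sub_add_cancel]
      _ ≤ ‖mean f Q - c‖ₑ + ‖c‖ₑ := enorm_add_le _ _
      _ ≤ (2 + 2 * 15 ^ n) + 2 := by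
          gcongr
          rw [Real.enorm_of_nonneg hc0, ← ENNReal.ofReal_ofNat]
          exact ENNReal.ofReal_le_ofReal (by linarith)
      _ = _ := by ring
  have hsub : ∀ k, (⋃ P ∈ layer F Q k, P.toSet) ⊆ Q.toSet := fun k =>
    iUnion₂_subset fun P hP => (exists_eq_cubeAt (hF.1 hP.1)).1
  have hlc : ∀ k, (layer F Q k).Countable := fun k =>
    ((countable_dyadic Q).mono hF.1).mono (sep_subset _ _)
  have hdisj : ∀ k, (layer F Q k).PairwiseDisjoint Cube.toSet := by
    intro k P hP R hR hne
    refine Set.disjoint_left.2 fun x hxP hxR => hne ?_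
    obtain ⟨-, a, ha, hP'⟩ := exists_eq_cubeAt (hF.1 hP.1)
    obtain ⟨-, b, hb, hR'⟩ := exists_eq_cubeAt (hF.1 hR.1)
    rw [hP' x hxP, hR' x hxR, (strictAnti_side Q).injective (ha.symm.trans hP.2),
      (strictAnti_side Q).injective (hb.symm.trans hR.2)]
  have hlayer : ∀ k, ∑' P : layer F Q k, wMass w P.1.toSet ≤
      ∫⁻ x in Q.toSet, ‖bump F Q k x‖ₑ * ENNReal.ofReal (w x) := by
    intro k
    have hm : MeasurableSet (⋃ P ∈ layer F Q k, P.toSet) :=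
      MeasurableSet.biUnion (hlc k) fun P _ => P.measurableSet_toSet
    calc ∑' P : layer F Q k, wMass w P.1.toSet
        = ∫⁻ x in ⋃ P ∈ layer F Q k, P.toSet, ENNReal.ofReal (w x) :=
          (lintegral_biUnion (hlc k) (fun P _ => P.measurableSet_toSet) (hdisj k) _).symm
      _ = ∫⁻ x in ⋃ P ∈ layer F Q k, P.toSet, ‖bump F Q k x‖ₑ * ENNReal.ofReal (w x) :=
          setLIntegral_congr_fun hm fun x hx => by
            rw [bump_eq_one hx, enorm_one, one_mul]
      _ ≤ _ := lintegral_mono_set (hsub k)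
  calc ∑ k ∈ Finset.range K, ∑' P : layer F Q k, wMass w P.1.toSet
      ≤ ∑ k ∈ Finset.range K, ∫⁻ x in Q.toSet, ‖bump F Q k x‖ₑ * ENNReal.ofReal (w x) :=
        Finset.sum_le_sum fun k _ => hlayer k
    _ = ∫⁻ x in Q.toSet, ∑ k ∈ Finset.range K, ‖bump F Q k x‖ₑ * ENNReal.ofReal (w x) :=
        (lintegral_finsetSum' _ fun k _ =>
          (continuous_bump.measurable.enorm.aemeasurable.mul hw.aemeasurable.restrict)).symm
    _ = ∫⁻ x in Q.toSet, ‖f x‖ₑ * ENNReal.ofReal (w x) := by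
        refine lintegral_congr fun x => ?_
        rw [← Finset.sum_mul]
        congr 1
        simp only [f, bumpSum]
        rw [Real.enorm_of_nonneg (Finset.sum_nonneg fun _ _ => bump_nonneg),
          ENNReal.ofReal_sum_of_nonneg fun _ _ => bump_nonneg]
        exact Finset.sum_congr rfl fun k _ => Real.enorm_of_nonneg bump_nonneg
    _ ≤ ∫⁻ x in Q.toSet, (‖f x - mean f Q‖ₑ * ENNReal.ofReal (w x) +
          ‖mean f Q‖ₑ * ENNReal.ofReal (w x)) := by
        refine lintegral_mono fun x => ?_
        rw [← add_mul]
        gcongr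
        conv_lhs => rw [← sub_add_cancel (f x) (mean f Q)]
        exact enorm_add_le _ _
    _ = (∫⁻ x in Q.toSet, ‖f x - mean f Q‖ₑ * ENNReal.ofReal (w x)) +
          ‖mean f Q‖ₑ * wMass w Q.toSet := by
        rw [lintegral_add_right' _ (hw.aemeasurable.restrict.const_mul _),
          lintegral_const_mul' _ _ enorm_ne_top, wMass]
    _ ≤ 2 * (2 + 2 * 15 ^ n) * bmoEmbeddingConst w * wMass w Q.toSet +
          (4 + 2 * 15 ^ n) * (2 ^ n * bmoEmbeddingConst w) * wMass w Q.toSet := by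
        gcongr
        exact hmean.trans (le_mul_of_one_le_right' (one_le_bmoEmbeddingConst hn hw))
    _ ≤ 2 * (2 + 2 * 15 ^ n) * (2 ^ n * bmoEmbeddingConst w) * wMass w Q.toSet +
          (4 + 2 * 15 ^ n) * (2 ^ n * bmoEmbeddingConst w) * wMass w Q.toSet := by
        gcongr
        exact le_mul_of_one_le_left' (one_le_pow₀ one_le_two)
    _ = _ := by ring

theorem sparseConst_le_bmoEmbeddingConst (hn : 1 ≤ n) (hw : IsWeight w) :
    sparseConst (1 / 2) w ≤ (8 + 6 * 15 ^ n) * 2 ^ n * bmoEmbeddingConst w := by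
  refine iSup_le fun Q => iSup₂_le fun F hF => ENNReal.div_le_of_le_mul ?_
  have hFU : F ⊆ ⋃ k, layer F Q k := fun P hP => by
    obtain ⟨-, k, hk, -⟩ := exists_eq_cubeAt (hF.1 hP)
    exact mem_iUnion.2 ⟨k, hP, hk⟩
  calc ∑' P : F, wMass w P.1.toSet
      ≤ ∑' P : ⋃ k, layer F Q k, wMass w P.1.toSet :=
        ENNReal.tsum_mono_subtype (fun P : Cube n => wMass w P.toSet) hFU
    _ ≤ ∑' k, ∑' P : layer F Q k, wMass w P.1.toSet :=
        ENNReal.tsum_iUnion_le_tsum (fun P : Cube n => wMass w P.toSet) _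
    _ ≤ _ := ENNReal.tsum_le_of_sum_range_le fun K => sum_wMass_layer_le hn hw hF K

/-! ### Sparse domination of functions of bounded mean oscillation -/

/-- Up to a null set a cube is a sup-norm ball, so differentiation along balls applies to cubes. -/
theorem Cube.toSet_ae_eq_closedBall (Q : Cube n) :
    Q.toSet =ᵐ[volume] Metric.closedBall (fun i => Q.corner i + Q.side / 2) (Q.side / 2) := by
  have h : Metric.closedBall (fun i => Q.corner i + Q.side / 2) (Q.side / 2) =
      Icc Q.corner fun i => Q.corner i + Q.side := by
    rw [closedBall_pi _ (by have := Q.side_pos; positivity), ← pi_univ_Icc]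
    congr 1
    funext i
    rw [Real.closedBall_eq_Icc]
    congr 1 <;> ring
  rw [h, Q.toSet_eq_pi]
  exact Measure.univ_pi_Ico_ae_eq_Icc

/-- Lebesgue differentiation along the dyadic cubes that contain a point. -/
theorem ae_tendsto_mean_cubeAt (hf : LocallyIntegrable f volume) (Q : Cube n) :
    ∀ᵐ x, x ∈ Q.toSet →
      Filter.Tendsto (fun k => mean f (cubeAt Q k x)) Filter.atTop (nhds (f x)) := by
  filter_upwards [IsUnifLocDoublingMeasure.ae_tendsto_average volume hf 1] with x hx hxQ
  have hlim : Filter.Tendsto (fun k : ℕ => (cubeAt Q k x).side / 2) Filter.atTop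
      (nhdsWithin 0 (Ioi 0)) := by
    refine tendsto_nhdsWithin_iff.2 ⟨?_, .of_forall fun k => half_pos (Cube.side_pos _)⟩
    have h := (tendsto_pow_atTop_nhds_zero_of_lt_one (r := (1 / 2 : ℝ)) (by norm_num)
      (by norm_num)).const_mul (Q.side / 2)
    rw [mul_zero] at h
    refine h.congr fun k => ?_
    rw [cubeAt_side, one_div, inv_pow]
    ring
  refine (hx (fun k i => (cubeAt Q k x).corner i + (cubeAt Q k x).side / 2)
    (fun k => (cubeAt Q k x).side / 2) hlim (.of_forall fun k => ?_)).congr fun k => ?_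
  · have hs := (cubeAt Q k x).side_pos
    rw [one_mul, Metric.mem_closedBall, dist_pi_le_iff (by positivity)]
    intro i
    have := mem_cubeAt (k := k) hxQ i
    rw [Real.dist_eq, abs_le]
    constructor <;> linarith
  · exact (setAverage_congr (Cube.toSet_ae_eq_closedBall _)).symm

/-- The stopping condition for `f`: the mean oscillation about the mean over the last stopping
cube is large. -/
def oscStop (f : (Fin n → ℝ) → ℝ) (P R : Cube n) : Prop :=
  2 * volume R.toSet < ∫⁻ x in R.toSet, ‖f x - mean f P‖ₑ

/-- The comparison measure is `½ |f - ⟨f⟩_P| dx`: it gives `P` mass at most `|P|/2` by the `BMO`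
bound, and each selected `R` more than `|R|`. -/
theorem isSparse_stopFamily_oscStop (hbmo : bmoNorm f ≤ 1) (Q : Cube n) :
    IsSparse (1 / 2) Q (stopFamily Q (oscStop f)) := by
  refine isSparse_stopFamily fun P _ =>
    ⟨(2⁻¹ : ℝ≥0∞) • volume.withDensity fun x => ‖f x - mean f P‖ₑ, ?_, fun R _ _ hs => ?_⟩
  · rw [Measure.smul_apply, withDensity_apply _ P.measurableSet_toSet, smul_eq_mul, ← mul_assoc,
      ENNReal.mul_inv_cancel (by simp) (by simp)]
    simpa using lintegral_sub_mean_le_of_bmoNorm_le hbmo P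
  · rw [Measure.smul_apply, withDensity_apply _ R.measurableSet_toSet, smul_eq_mul,
      ← ENNReal.div_eq_inv_mul, ENNReal.le_div_iff_mul_le (by simp) (by simp), mul_comm]
    exact hs.le

theorem not_oscStop_self (hbmo : bmoNorm f ≤ 1) (P : Cube n) : ¬ oscStop f P P := by
  rw [oscStop, not_lt]
  exact (lintegral_sub_mean_le_of_bmoNorm_le hbmo P).trans (by gcongr; exact one_le_two)

theorem lintegral_sub_mean_stopGen_le (hbmo : bmoNorm f ≤ 1) (hx : x ∈ Q.toSet) (k : ℕ) :
    ∫⁻ y in (cubeAt Q k x).toSet, ‖f y - mean f (cubeAt Q (stopGen Q (oscStop f) k x) x)‖ₑ ≤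
      2 * volume (cubeAt Q k x).toSet :=
  not_lt.1 (not_stop_cubeAt (fun P _ => not_oscStop_self hbmo P) hx k)

/-- Telescoping over the stops: the parent of a new stopping cube satisfies the oscillation bound
`2`, and passing to the child costs `2^n`, so each stop moves the mean by at most `2^(n+1)`. -/
theorem enorm_mean_stopGen_sub_le (hf : LocallyIntegrable f volume) (hbmo : bmoNorm f ≤ 1)
    (hx : x ∈ Q.toSet) (k : ℕ) :
    ‖mean f (cubeAt Q (stopGen Q (oscStop f) k x) x) - mean f Q‖ₑ ≤
      2 ^ (n + 1) *
        ((Finset.range k).filter fun j => stopGen Q (oscStop f) (j + 1) x = j + 1).card := by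
  induction k with
  | zero => simp [stopGen, cubeAt_zero hx]
  | succ k ih =>
    rw [Finset.range_add_one, Finset.filter_insert]
    by_cases hs : oscStop f (cubeAt Q (stopGen Q (oscStop f) k x) x) (cubeAt Q (k + 1) x)
    · rw [if_pos (stopGen_succ_of_stop hs), Finset.card_insert_of_notMem (by simp),
        stopGen_succ_of_stop hs]
      set g := stopGen Q (oscStop f) k x
      have h1 : ‖mean f (cubeAt Q (k + 1) x) - mean f (cubeAt Q g x)‖ₑ ≤ 2 ^ (n + 1) := by
        refine enorm_mean_sub_le hf ?_
        calc ∫⁻ y in (cubeAt Q (k + 1) x).toSet, ‖f y - mean f (cubeAt Q g x)‖ₑ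
            ≤ ∫⁻ y in (cubeAt Q k x).toSet, ‖f y - mean f (cubeAt Q g x)‖ₑ :=
              lintegral_mono_set (cubeAt_subset_cubeAt (Nat.le_succ k))
          _ ≤ 2 * volume (cubeAt Q k x).toSet := lintegral_sub_mean_stopGen_le hbmo hx k
          _ = _ := by rw [← volume_cubeAt_succ]; ring
      rw [← sub_add_sub_cancel _ (mean f (cubeAt Q g x)), Nat.cast_add, Nat.cast_one, mul_add,
        mul_one, add_comm (2 ^ (n + 1) * _)]
      exact (enorm_add_le _ _).trans (add_le_add h1 ih)
    · rw [stopGen_succ_of_not_stop hs, if_neg]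
      · exact ih
      · have := stopGen_le (Q := Q) (sel := oscStop f) k x
        omega

theorem enorm_mean_cubeAt_sub_le (hf : LocallyIntegrable f volume) (hbmo : bmoNorm f ≤ 1)
    (hx : x ∈ Q.toSet) (k : ℕ) :
    ‖mean f (cubeAt Q k x) - mean f Q‖ₑ ≤
      2 ^ (n + 1) * ∑' P : stopFamily Q (oscStop f), P.1.toSet.indicator 1 x := by
  set g := stopGen Q (oscStop f) k x
  set A := (Finset.range k).filter fun j => stopGen Q (oscStop f) (j + 1) x = j + 1
  have h1 : ‖mean f (cubeAt Q k x) - mean f (cubeAt Q g x)‖ₑ ≤ 2 ^ (n + 1) :=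
    (enorm_mean_sub_le hf (lintegral_sub_mean_stopGen_le hbmo hx k)).trans
      (by rw [pow_succ']; exact le_mul_of_one_le_right' (one_le_pow₀ one_le_two))
  -- `Q` itself, of generation `0`, is a stopping cube not counted in `A`; this extra unit pays for
  -- the passage from the last stopping cube to generation `k`.
  have hcard : (A.card : ℝ≥0∞) + 1 ≤
      ∑' P : stopFamily Q (oscStop f), P.1.toSet.indicator 1 x := by
    have h := card_le_tsum_of_injOn (insert 0 (A.image Nat.succ)) (stopFamily Q (oscStop f))
      (fun P => P.toSet.indicator 1 x) (fun j => cubeAt Q j x) (fun j hj => ⟨?_, ?_⟩)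
      fun a _ b _ hab => (strictAnti_side Q).injective (congrArg Cube.side hab)
    · rw [Finset.card_insert_of_notMem (by simp),
        Finset.card_image_of_injective _ Nat.succ_injective] at h
      exact_mod_cast h
    · have hj : stopGen Q (oscStop f) j x = j := by
        rcases Finset.mem_insert.1 hj with rfl | hj
        · rfl
        · obtain ⟨i, hi, rfl⟩ := Finset.mem_image.1 hj
          exact (Finset.mem_filter.1 hi).2
      exact ⟨j, x, hx, hj, rfl⟩
    · rw [indicator_of_mem (mem_cubeAt hx)]; rfl
  calc ‖mean f (cubeAt Q k x) - mean f Q‖ₑ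
      ≤ ‖mean f (cubeAt Q k x) - mean f (cubeAt Q g x)‖ₑ +
        ‖mean f (cubeAt Q g x) - mean f Q‖ₑ := by
        rw [← sub_add_sub_cancel _ (mean f (cubeAt Q g x))]
        exact enorm_add_le _ _
    _ ≤ 2 ^ (n + 1) + 2 ^ (n + 1) * A.card :=
        add_le_add h1 (enorm_mean_stopGen_sub_le hf hbmo hx k)
    _ = 2 ^ (n + 1) * (A.card + 1) := by ring
    _ ≤ _ := by gcongr

theorem ae_enorm_sub_mean_le (hf : LocallyIntegrable f volume) (hbmo : bmoNorm f ≤ 1)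
    (Q : Cube n) : ∀ᵐ x, x ∈ Q.toSet → ‖f x - mean f Q‖ₑ ≤
      2 ^ (n + 1) * ∑' P : stopFamily Q (oscStop f), P.1.toSet.indicator 1 x := by
  filter_upwards [ae_tendsto_mean_cubeAt hf Q] with x hx hxQ
  exact le_of_tendsto ((hx hxQ).sub_const _).enorm
    (.of_forall fun k => enorm_mean_cubeAt_sub_le hf hbmo hxQ k)

theorem bmoEmbeddingConst_le_sparseConst (hw : IsWeight w) :
    bmoEmbeddingConst w ≤ 2 ^ (n + 1) * sparseConst (1 / 2) w := by
  refine iSup_le fun f => iSup₂_le fun hf hbmo => iSup_le fun Q => ENNReal.div_le_of_le_mul ?_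
  have hsparse := isSparse_stopFamily_oscStop hbmo Q
  set F := stopFamily Q (oscStop f)
  have := ((countable_dyadic Q).mono hsparse.1).to_subtype
  calc ∫⁻ x in Q.toSet, ‖f x - mean f Q‖ₑ * ENNReal.ofReal (w x)
      ≤ ∫⁻ x in Q.toSet, 2 ^ (n + 1) *
          ∑' P : F, P.1.toSet.indicator (fun x => ENNReal.ofReal (w x)) x := by
        refine lintegral_mono_ae ((ae_restrict_iff' Q.measurableSet_toSet).2 ?_)
        filter_upwards [ae_enorm_sub_mean_le hf hbmo Q] with x hx hxQ
        refine (mul_le_mul_left (hx hxQ) _).trans (le_of_eq ?_)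
        rw [mul_assoc, ← ENNReal.tsum_mul_right]
        congr 2
        funext P
        by_cases hxP : x ∈ P.1.toSet
        · rw [indicator_of_mem hxP, indicator_of_mem hxP, Pi.one_apply, one_mul]
        · rw [indicator_of_notMem hxP, indicator_of_notMem hxP, zero_mul]
    _ ≤ ∫⁻ x, 2 ^ (n + 1) *
          ∑' P : F, P.1.toSet.indicator (fun x => ENNReal.ofReal (w x)) x :=
        setLIntegral_le_lintegral _ _
    _ = 2 ^ (n + 1) * ∑' P : F, wMass w P.1.toSet := by
        rw [lintegral_const_mul' _ _ (by finiteness),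
          lintegral_tsum fun P => hw.aemeasurable.indicator (Cube.measurableSet_toSet _)]
        congr 2
        funext P
        exact lintegral_indicator (Cube.measurableSet_toSet _) _
    _ ≤ 2 ^ (n + 1) * (sparseConst (1 / 2) w * wMass w Q.toSet) := by
        gcongr
        exact tsum_wMass_le_sparseConst hw hsparse
    _ = _ := by ring

end AInfty

end

/-! ### Combining the four inequalities -/

theorem mainTheorem8 (n : ℕ) (hn : 1 ≤ n) :
    ∃ C : ℝ≥0, 0 < C ∧ ∀ w : (Fin n → ℝ) → ℝ, AInfty.IsWeight w →
      (AInfty.fujiiWilson w ≤ C * AInfty.bmoEmbeddingConst w ∧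
        AInfty.bmoEmbeddingConst w ≤ C * AInfty.fujiiWilson w) ∧
      (AInfty.fujiiWilson w ≤ C * AInfty.sparseConst (1 / 2) w ∧
        AInfty.sparseConst (1 / 2) w ≤ C * AInfty.fujiiWilson w) := by
  let a : ℝ≥0 := 2 * 18 ^ n
  let b : ℝ≥0 := (8 + 6 * 15 ^ n) * 2 ^ n
  let c : ℝ≥0 := 2 ^ (n + 1)
  -- The sum of the four constants dominates each of them; `a * b` and `c * 2` arise by composing
  -- through the sparse constant.
  refine ⟨a * b + c * 2 + a + 2, by positivity, fun w hw => ?_⟩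
  have h1 : AInfty.fujiiWilson w ≤ a * AInfty.sparseConst (1 / 2) w := by
    simpa [a] using AInfty.fujiiWilson_le_sparseConst hw
  have h2 : AInfty.sparseConst (1 / 2) w ≤ b * AInfty.bmoEmbeddingConst w := by
    simpa [b] using AInfty.sparseConst_le_bmoEmbeddingConst hn hw
  have h3 : AInfty.bmoEmbeddingConst w ≤ c * AInfty.sparseConst (1 / 2) w := by
    simpa [c] using AInfty.bmoEmbeddingConst_le_sparseConst hw
  have h4 : AInfty.sparseConst (1 / 2) w ≤ (2 : ℝ≥0) * AInfty.fujiiWilson w := by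
    simpa using AInfty.sparseConst_le_fujiiWilson hn hw
  have weaken : ∀ {d : ℝ≥0} {s t : ℝ≥0∞}, d ≤ a * b + c * 2 + a + 2 → s ≤ d * t →
      s ≤ (a * b + c * 2 + a + 2 : ℝ≥0) * t := fun hd hs => hs.trans (by gcongr)
  refine ⟨⟨weaken (d := a * b) ?_ ?_, weaken (d := c * 2) ?_ ?_⟩,
    ⟨weaken (d := a) ?_ h1, weaken (d := 2) ?_ h4⟩⟩
  · rw [add_assoc, add_assoc]; exact le_self_add
  · rw [ENNReal.coe_mul, mul_assoc]
    exact h1.trans (by gcongr)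
  · rw [add_comm (a * b), add_assoc, add_assoc]; exact le_self_add
  · rw [ENNReal.coe_mul, mul_assoc]
    exact h3.trans (by gcongr)
  · rw [add_comm _ a, add_assoc]; exact le_self_add
  · exact le_add_self
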